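/- Let $a<b$ and let $V\in L^1(\mathbb R,\mathbb R)$ have (essential) support $[a,b]$ and be positive, in the sense that $\langle u,Vu\rangle_{L^2(a,b)}=\int_a^b V|u|^2\,dx>0$ for every nonzero $u\in L^2(a,b)$ with $V|u|^2$ integrable. Solutions of $-u''+Vu=Eu$ on an open set are understood as $C^1$ functions there with locally absolutely continuous derivative satisfying the equation almost everywhere; $u(c^\pm)$ denote one-sided limits. *The problem.* For $k\in\mathbb R$ and $(\theta_1,\theta_2)\in\mathbb C^2$, an incoming generalized eigenfunction $\psi_-(\cdot,k,\theta_1,\theta_2)$ of $Q_{\theta_1,\theta_2}(V)$ is a solution $u$ of $-u''+Vu=k^2u$ on $\mathbb R\setminus\{a,b\}$ such that $$e^{-\theta_1/2}u(b^+)=u(b^-),\quad e^{-\theta_2/2}u'(b^+)=u'(b^-),\quad e^{-\theta_1/2}u(a^-)=u(a^+),\quad e^{-\theta_2/2}u'(a^-)=u'(a^+),$$ and, for some constants $R,T\in\mathbb C$: if $k\ge 0$, $u(x)=e^{ikx}+Re^{-ikx}$ for $x<a$ and $u(x)=Te^{ikx}$ for $x>b$; if $k<0$, $u(x)=Te^{ikx}$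 for $x<a$ and $u(x)=e^{ikx}+Re^{-ikx}$ for $x>b$. *Notation.* Let $\chi_\pm(\cdot,\zeta)$ be the Jost solutions, i.e. the solutions of $-u''+Vu=\zeta^2u$ on $\mathbb R$ with $\chi_+(x,\zeta)=e^{i\zeta x}$ for $x>b$ and $\chi_-(x,\zeta)=e^{-i\zeta x}$ for $x<a$; let $w(\zeta)=\chi_+\chi_-'-\chi_+'\chi_-$ be their (constant) Wronskian, and put $$G^\zeta(x,y)=\frac1{w(\zeta)}\begin{cases}\chi_+(x,\zeta)\chi_-(y,\zeta),&x\ge y,\\ \chi_-(x,\zeta)\chi_+(y,\zeta),&x<y,\end{cases}\qquad H^\zeta(x,y)=-\frac1{w(\zeta)}\begin{cases}\chi_+(x,\zeta)\chi_-'(y,\zeta),&x\ge y,\\ \chi_-(x,\zeta)\chi_+'(y,\zeta),&x<y,\end{cases}$$ $$g(e_1,\zeta)=G^\zeta(\cdot,b),\quad g(e_2,\zeta)=-H^\zeta(\cdot,b),\quad g(e_3,\zeta)=G^\zeta(\cdot,a),\quad g(e_4,\zeta)=-H^\zeta(\cdot,a).$$ Let $\psi_-(x,k)=-\frac{2ik}{w(k)}\chi_+(x,k)$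 for $k\ge0$ and $\psi_-(x,k)=\frac{2ik}{w(-k)}\chi_-(x,-k)$ for $k<0$. Let $$\Gamma_1u=\tfrac12\big(u(b^+)+u(b^-),\,u'(b^+)+u'(b^-),\,u(a^+)+u(a^-),\,u'(a^+)+u'(a^-)\big)^{T},$$ let $q(\zeta)$ be the $4\times4$ matrix with $j$-th column $\Gamma_1g(e_j,\zeta)$, let $$A_{\theta_1,\theta_2}=\mathrm{diag}\big(1+e^{\theta_2/2},\,1+e^{\theta_1/2},\,1+e^{-\theta_2/2},\,1+e^{-\theta_1/2}\big),$$ let $B_{\theta_1,\theta_2}$ be the block-diagonal matrix with diagonal blocks $b(\theta_1,\theta_2)$ and $b(-\theta_1,-\theta_2)$, where $b(\theta_1,\theta_2)=2\begin{pmatrix}0&1-e^{\theta_2/2}\\ e^{\theta_1/2}-1&0\end{pmatrix}$, and let $\mathcal M(\zeta,\theta_1,\theta_2)=B_{\theta_1,\theta_2}\,q(\zeta)-A_{\theta_1,\theta_2}$. *Claim.* There is $\delta>0$ (depending on $V$) such that for all $k\in\mathbb R$ and all $(\theta_1,\theta_2)$ with $|\theta_1|,|\theta_2|<\delta$ the matrix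 $\mathcal M(k,\theta_1,\theta_2)$ is invertible, the problem has a solution $\psi_-(\cdot,k,\theta_1,\theta_2)$, and every solution is given on $\mathbb R\setminus\{a,b\}$ by $$\psi_-(\cdot,k,\theta_1,\theta_2)=\psi_-(\cdot,k)-\sum_{i,j=1}^4\big[\mathcal M^{-1}(\sigma k,\theta_1,\theta_2)B_{\theta_1,\theta_2}\big]_{ij}\,[\Gamma_1\psi_-(\cdot,k)]_j\;g(e_i,\sigma k),$$ with $\sigma=1$ for $k\ge0$ and $\sigma=-1$ for $k<0$. Moreover $x\mapsto\psi_-(x,k,\theta_1,\theta_2)$ is $C^1$ on $\mathbb R\setminus\{a,b\}$ for all such $k,\theta_1,\theta_2$, and for every $x\in\mathbb R\setminus\{a,b\}$ the function $\psi_-(x,k,\theta_1,\theta_2)$ is continuous in $k\in\mathbb R$ and holomorphic in $(\theta_1,\theta_2)$ on $\{|\theta_1|,|\theta_2|<\delta\}$. -/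

import Mathlib

open MeasureTheory Set Filter Topology

noncomputable section

namespace InterfaceSchrodinger

/-- The (essential) support of a function on the line, insensitive to changes on null sets: the
points none of whose neighbourhoods carries a null restriction of `V`. -/
def essSupport (V : ℝ → ℝ) : Set ℝ :=
  {x | ∀ U ∈ 𝓝 x, ¬ V =ᵐ[volume.restrict U] 0}

/-- `⟨u, V u⟩_{L²(a,b)} > 0` for every nonzero `u ∈ L²(a,b)` in the form domain of `V`
(for `V ∈ L¹` the form is finite only on those `u` with `V |u|²` integrable). -/
def FormPositive (V : ℝ → ℝ) (a b : ℝ) : Prop :=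
  ∀ u : ℝ → ℂ, MemLp u 2 (volume.restrict (Ioo a b)) →
    ¬ u =ᵐ[volume.restrict (Ioo a b)] 0 →
    IntegrableOn (fun x => V x * ‖u x‖ ^ 2) (Ioo a b) volume →
    0 < ∫ x in Ioo a b, V x * ‖u x‖ ^ 2

/-- `u` solves `-u'' + V u = E u` on the open set `s`: `u` is differentiable there, `u'` is locally
absolutely continuous, and the equation holds almost everywhere. The last two properties are
written in the equivalent integrated form on the compact intervals contained in `s`. -/
structure SolvesOn (V : ℝ → ℝ) (E : ℂ) (s : Set ℝ) (u : ℝ → ℂ) : Prop where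
  differentiableAt : ∀ x ∈ s, DifferentiableAt ℝ u x
  deriv_sub : ∀ x y : ℝ, uIcc x y ⊆ s →
    deriv u y - deriv u x = ∫ t in x..y, ((V t : ℂ) - E) * u t

/-- The defining property of the Jost solution `χ₊(·, ζ)`. -/
def IsJostPlus (V : ℝ → ℝ) (b : ℝ) (ζ : ℂ) (u : ℝ → ℂ) : Prop :=
  SolvesOn V (ζ ^ 2) univ u ∧ ∀ x, b < x → u x = Complex.exp (Complex.I * ζ * x)

/-- The defining property of the Jost solution `χ₋(·, ζ)`. -/
def IsJostMinus (V : ℝ → ℝ) (a : ℝ) (ζ : ℂ) (u : ℝ → ℂ) : Prop :=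
  SolvesOn V (ζ ^ 2) univ u ∧ ∀ x, x < a → u x = Complex.exp (-(Complex.I * ζ * x))

/-- The Jost solution `χ₊(·, ζ)`: the function with the property `IsJostPlus`. -/
def jostPlus (V : ℝ → ℝ) (b : ℝ) (ζ : ℂ) : ℝ → ℂ :=
  Classical.epsilon (IsJostPlus V b ζ)

/-- The Jost solution `χ₋(·, ζ)`: the function with the property `IsJostMinus`. -/
def jostMinus (V : ℝ → ℝ) (a : ℝ) (ζ : ℂ) : ℝ → ℂ :=
  Classical.epsilon (IsJostMinus V a ζ)

/-- The Wronskian `f g' - f' g` at the point `x`. -/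
def wronskian (f g : ℝ → ℂ) (x : ℝ) : ℂ := f x * deriv g x - deriv f x * g x

/-- The Jost function `w(ζ)`, the Wronskian of `χ₊(·, ζ)` and `χ₋(·, ζ)`. It does not depend on
the point where it is evaluated; the point `a` is used. -/
def jostFunction (V : ℝ → ℝ) (a b : ℝ) (ζ : ℂ) : ℂ :=
  wronskian (jostPlus V b ζ) (jostMinus V a ζ) a

/-- The Green function `G^ζ(x, y)`. -/
def greenG (V : ℝ → ℝ) (a b : ℝ) (ζ : ℂ) (x y : ℝ) : ℂ :=
  1 / jostFunction V a b ζ *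
    (if y ≤ x then jostPlus V b ζ x * jostMinus V a ζ y
      else jostMinus V a ζ x * jostPlus V b ζ y)

/-- The function `H^ζ(x, y)`. -/
def greenH (V : ℝ → ℝ) (a b : ℝ) (ζ : ℂ) (x y : ℝ) : ℂ :=
  -(1 / jostFunction V a b ζ) *
    (if y ≤ x then jostPlus V b ζ x * deriv (jostMinus V a ζ) y
      else jostMinus V a ζ x * deriv (jostPlus V b ζ) y)

/-- The defect functions `g(e_i, ζ)`:
`G^ζ(·, b)`, `-H^ζ(·, b)`, `G^ζ(·, a)`, `-H^ζ(·, a)`. -/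
def defectFun (V : ℝ → ℝ) (a b : ℝ) (i : Fin 4) (ζ : ℂ) (x : ℝ) : ℂ :=
  ![greenG V a b ζ x b, -greenH V a b ζ x b, greenG V a b ζ x a, -greenH V a b ζ x a] i

/-- The boundary map
`Γ₁ u = ½ (u(b⁺)+u(b⁻), u'(b⁺)+u'(b⁻), u(a⁺)+u(a⁻), u'(a⁺)+u'(a⁻))`. -/
def boundaryOne (a b : ℝ) (u : ℝ → ℂ) : Fin 4 → ℂ :=
  ![(Function.rightLim u b + Function.leftLim u b) / 2,
    (Function.rightLim (deriv u) b + Function.leftLim (deriv u) b) / 2,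
    (Function.rightLim u a + Function.leftLim u a) / 2,
    (Function.rightLim (deriv u) a + Function.leftLim (deriv u) a) / 2]

/-- The Weyl function `q(ζ) = Γ₁ ∘ γ`, as a matrix: its `j`-th column is `Γ₁ g(e_j, ζ)`. -/
def weylMatrix (V : ℝ → ℝ) (a b : ℝ) (ζ : ℂ) : Matrix (Fin 4) (Fin 4) ℂ :=
  Matrix.of fun i j => boundaryOne a b (defectFun V a b j ζ) i

/-- The matrix `A_{θ₁,θ₂}`, with `θ = (θ₁, θ₂)`. -/
def matA (θ : ℂ × ℂ) : Matrix (Fin 4) (Fin 4) ℂ :=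
  Matrix.diagonal ![1 + Complex.exp (θ.2 / 2), 1 + Complex.exp (θ.1 / 2),
    1 + Complex.exp (-θ.2 / 2), 1 + Complex.exp (-θ.1 / 2)]

/-- The matrix `B_{θ₁,θ₂}`, with `θ = (θ₁, θ₂)`. -/
def matB (θ : ℂ × ℂ) : Matrix (Fin 4) (Fin 4) ℂ :=
  !![0, 2 * (1 - Complex.exp (θ.2 / 2)), 0, 0;
     2 * (Complex.exp (θ.1 / 2) - 1), 0, 0, 0;
     0, 0, 0, 2 * (1 - Complex.exp (-θ.2 / 2));
     0, 0, 2 * (Complex.exp (-θ.1 / 2) - 1), 0]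

/-- The matrix `M(ζ, θ₁, θ₂) = B_{θ₁,θ₂} q(ζ) - A_{θ₁,θ₂}`. -/
def matM (V : ℝ → ℝ) (a b : ℝ) (ζ : ℂ) (θ : ℂ × ℂ) : Matrix (Fin 4) (Fin 4) ℂ :=
  matB θ * weylMatrix V a b ζ - matA θ

/-- The unperturbed generalized eigenfunction `ψ₋(·, k)`, given by the Jost solutions. -/
def psiZero (V : ℝ → ℝ) (a b k : ℝ) (x : ℝ) : ℂ :=
  if 0 ≤ k then
    -(2 * Complex.I * k) / jostFunction V a b (k : ℂ) * jostPlus V b (k : ℂ) x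
  else
    2 * Complex.I * k / jostFunction V a b (-k : ℂ) * jostMinus V a (-k : ℂ) x

/-- `u` solves the generalized eigenfunction problem of momentum `k` for the operator
`Q_{θ₁,θ₂}(V)`, with `θ = (θ₁, θ₂)`: the equation off `{a, b}`, the interface conditions at `a` and
`b`, and the exterior conditions of an incoming wave of momentum `k`. For `k = 0` the exterior
conditions are those of the case `k > 0`. Values of `u` at `a` and `b` play no role. -/
structure IsIncoming (V : ℝ → ℝ) (a b k : ℝ) (θ : ℂ × ℂ) (u : ℝ → ℂ) : Prop where
  solves : SolvesOn V ((k : ℂ) ^ 2) ({a, b}ᶜ : Set ℝ) u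
  value_b : Complex.exp (-θ.1 / 2) * Function.rightLim u b = Function.leftLim u b
  deriv_b : Complex.exp (-θ.2 / 2) * Function.rightLim (deriv u) b = Function.leftLim (deriv u) b
  value_a : Complex.exp (-θ.1 / 2) * Function.leftLim u a = Function.rightLim u a
  deriv_a : Complex.exp (-θ.2 / 2) * Function.leftLim (deriv u) a = Function.rightLim (deriv u) a
  exterior_nonneg : 0 ≤ k → ∃ R T : ℂ,
    (∀ x, x < a → u x = Complex.exp (Complex.I * k * x) + R * Complex.exp (-(Complex.I * k * x))) ∧
    (∀ x, b < x → u x = T * Complex.exp (Complex.I * k * x))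
  exterior_neg : k < 0 → ∃ R T : ℂ,
    (∀ x, x < a → u x = T * Complex.exp (Complex.I * k * x)) ∧
    (∀ x, b < x → u x = Complex.exp (Complex.I * k * x) + R * Complex.exp (-(Complex.I * k * x)))

end InterfaceSchrodinger

end

open InterfaceSchrodinger

/-! Off the points `a` and `b`, every solution is a combination of the Jost solutions on each of the
three components, provided the Jost function does not vanish at the momentum `ζ = |k|`. Once the
incoming amplitude is prescribed, four coefficients remain free. They can be traded for the
coefficients `c` of the four defect functions, because up to sign `c` lists the jumps of `u` and
`u'` at `a` and `b` (`hasTraces_combDefect`). In terms of the averages `Γ` and the jumps `c` the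
interface conditions become the linear system `B Γ = A c` (`satisfiesInterface_iff`). Since `Γ = Γ₁
φ + q c` for the unperturbed wave `φ`, this is `M c = -B Γ₁ φ`. Hence invertibility of `M` gives
existence, uniqueness and the formula all at once.

Two analytic facts remain. For real `k`, conservation of the flux `Im (u' ū)` gives `|w(k)|² =
k²|χ₊(a)|² + |χ₊'(a)|² + 2k²`, and a mirror identity for `χ₋(b)`. So `w(k) ≠ 0` for `k ≠ 0`; at `k =
0` a zero of `w` would make `χ₊` a Neumann solution on `[a,b]`, which positivity of `V` forbids
(`jostFunction_zero_ne_zero`).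

Invertibility must be uniform in `k`, although `q(k)` may grow in its derivative entries. The same
identities give `|q_ij| ≤ C s_i s_j / (1+|k|)`, with weight `s = 1` for values and `s = 1+|k|` for
derivatives (`exists_weylMatrix_bound`). As `B` exchanges values and derivatives at each point,
conjugation by `diag(s)` makes `B q` small uniformly in `k` when `θ` is small, while `A` stays near
`2`; diagonal dominance concludes (`exists_isUnit_matM`). The ball in `ℂ × ℂ` is a polydisc, the
product norm being the maximum.

Regularity is read off the formula: Cramer's rule in `θ`, and in `k` the continuity of the Jost
solutions, which comes from inverting a Volterra operator of norm less than one
(`exists_solution_family`). -/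

namespace InterfaceSchrodinger

/-! ### Products of primitives of integrable functions -/

/-- The increments of `∫ f` are dominated by those of the real primitive `∫ ‖f‖`, for which absolute
continuity is known. -/
theorem absolutelyContinuousOnInterval_primitive {f : ℝ → ℂ} {x y : ℝ}
    (hf : IntervalIntegrable f volume x y) :
    AbsolutelyContinuousOnInterval (fun t => ∫ s in x..t, f s) x y := by
  have h := hf.norm.absolutelyContinuousOnInterval_intervalIntegral (c := x) left_mem_uIcc
  unfold AbsolutelyContinuousOnInterval at h ⊢
  refine squeeze_zero' ?_ ?_ h
  · exact Eventually.of_forall fun _ => Finset.sum_nonneg fun _ _ => dist_nonneg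
  rw [eventually_inf_principal]
  filter_upwards with E hE
  refine Finset.sum_le_sum fun i hi => ?_
  obtain ⟨h1, h2⟩ := hE.1 i hi
  have hs : ∀ {t}, t ∈ uIcc x y → IntervalIntegrable f volume x t := fun ht =>
    hf.mono_set (uIcc_subset_uIcc_left ht)
  rw [dist_eq_norm, dist_eq_norm, intervalIntegral.integral_interval_sub_left (hs h1) (hs h2),
    intervalIntegral.integral_interval_sub_left (hs h1).norm (hs h2).norm]
  exact intervalIntegral.norm_integral_le_abs_integral_norm

/-- Integration by parts for primitives of integrable functions. -/
theorem mul_sub_mul_eq_integral {f g f' g' : ℝ → ℂ} {x y : ℝ}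
    (hf' : IntervalIntegrable f' volume x y) (hg' : IntervalIntegrable g' volume x y)
    (hf : ∀ t ∈ uIcc x y, f t - f x = ∫ s in x..t, f' s)
    (hg : ∀ t ∈ uIcc x y, g t - g x = ∫ s in x..t, g' s) :
    f y * g y - f x * g x = ∫ t in x..y, (f' t * g t + f t * g' t) := by
  -- `F` and `G` agree with `f` and `g` on the interval and are absolutely continuous by
  -- construction.
  set F : ℝ → ℂ := fun t => f x + ∫ s in x..t, f' s with hF
  set G : ℝ → ℂ := fun t => g x + ∫ s in x..t, g' s with hG
  have hconst : ∀ c : ℂ, AbsolutelyContinuousOnInterval (fun _ : ℝ => c) x y := fun c =>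
    (LipschitzWith.const c).lipschitzOnWith.absolutelyContinuousOnInterval
  have aF : AbsolutelyContinuousOnInterval F x y :=
    (hconst _).add (absolutelyContinuousOnInterval_primitive hf')
  have aG : AbsolutelyContinuousOnInterval G x y :=
    (hconst _).add (absolutelyContinuousOnInterval_primitive hg')
  have hint : IntervalIntegrable (fun t => f' t * G t + F t * g' t) volume x y :=
    (hf'.mul_continuousOn aG.continuousOn).add (hg'.continuousOn_mul aF.continuousOn)
  have aH : AbsolutelyContinuousOnInterval
      (fun t => F t * G t - ∫ s in x..t, (f' s * G s + F s * g' s)) x y :=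
    (aF.smul aG).sub (absolutelyContinuousOnInterval_primitive hint)
  -- An absolutely continuous function whose derivative vanishes almost everywhere is constant.
  obtain ⟨C, hC⟩ := aH.const_of_ae_hasDerivAt_zero (by
    filter_upwards [hf'.ae_hasDerivAt_integral, hg'.ae_hasDerivAt_integral,
      hint.ae_hasDerivAt_integral] with t h1 h2 h3 ht
    have h1 := (h1 ht x left_mem_uIcc).const_add (f x)
    have h2 := (h2 ht x left_mem_uIcc).const_add (g x)
    have := (h1.mul h2).sub (h3 ht x left_mem_uIcc)
    rwa [sub_self] at this)
  have e1 := hC x left_mem_uIcc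
  have e2 := hC y right_mem_uIcc
  have hfF : ∀ t ∈ uIcc x y, F t = f t := fun t ht => by rw [hF]; linear_combination -hf t ht
  have hgG : ∀ t ∈ uIcc x y, G t = g t := fun t ht => by rw [hG]; linear_combination -hg t ht
  have e3 : ∫ s in x..y, (f' s * G s + F s * g' s) = ∫ t in x..y, (f' t * g t + f t * g' t) :=
    intervalIntegral.integral_congr fun t ht => by simp only [hfF t ht, hgG t ht]
  simp only [hfF _ left_mem_uIcc, hgG _ left_mem_uIcc, hfF _ right_mem_uIcc,
    hgG _ right_mem_uIcc, e3, intervalIntegral.integral_same] at e1 e2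
  linear_combination e2 - e1

/-! ### Basic properties of solutions -/

theorem intervalIntegrable_potential {V : ℝ → ℝ} (hV : Integrable V volume) (E : ℂ) (x y : ℝ) :
    IntervalIntegrable (fun t => (V t : ℂ) - E) volume x y :=
  hV.ofReal.intervalIntegrable.sub (continuous_const.intervalIntegrable _ _)

namespace SolvesOn

variable {V : ℝ → ℝ} {E : ℂ} {s : Set ℝ} {u v : ℝ → ℂ}

theorem mono {t : Set ℝ} (hu : SolvesOn V E s u) (h : t ⊆ s) : SolvesOn V E t u :=
  ⟨fun x hx => hu.differentiableAt x (h hx), fun x y hxy => hu.deriv_sub x y (hxy.trans h)⟩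

theorem continuousOn (hu : SolvesOn V E s u) : ContinuousOn u s := fun x hx =>
  (hu.differentiableAt x hx).continuousAt.continuousWithinAt

theorem intervalIntegrable (hV : Integrable V volume) (hu : SolvesOn V E s u) {x y : ℝ}
    (h : uIcc x y ⊆ s) : IntervalIntegrable (fun t => ((V t : ℂ) - E) * u t) volume x y :=
  (intervalIntegrable_potential hV E x y).mul_continuousOn (hu.continuousOn.mono h)

theorem continuousOn_deriv_uIcc (hV : Integrable V volume) (hu : SolvesOn V E s u) {x y : ℝ}
    (h : uIcc x y ⊆ s) : ContinuousOn (deriv u) (uIcc x y) := by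
  have h1 := intervalIntegral.continuousOn_primitive_interval' (hu.intervalIntegrable hV h)
    left_mem_uIcc
  refine (h1.add (continuousOn_const (c := deriv u x))).congr fun t ht => ?_
  simp [← hu.deriv_sub x t ((uIcc_subset_uIcc_left ht).trans h)]

theorem sub_eq_integral_deriv (hV : Integrable V volume) (hu : SolvesOn V E s u) {x y : ℝ}
    (h : uIcc x y ⊆ s) : u y - u x = ∫ t in x..y, deriv u t :=
  (intervalIntegral.integral_eq_sub_of_hasDerivAt
    (fun t ht => (hu.differentiableAt t (h ht)).hasDerivAt)
    (hu.continuousOn_deriv_uIcc hV h).intervalIntegrable).symm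

theorem continuousOn_deriv (hV : Integrable V volume) (hs : IsOpen s) (hu : SolvesOn V E s u) :
    ContinuousOn (deriv u) s := by
  intro x hx
  obtain ⟨ε, hε, hb⟩ := Metric.isOpen_iff.1 hs x hx
  have hsub : uIcc (x - ε / 2) (x + ε / 2) ⊆ s := by
    rw [uIcc_of_le (by linarith)]
    intro t ht
    refine hb ?_
    rw [Metric.mem_ball, Real.dist_eq, abs_lt]
    constructor <;> linarith [ht.1, ht.2]
  refine ((hu.continuousOn_deriv_uIcc hV hsub).continuousAt ?_).continuousWithinAt
  rw [uIcc_of_le (by linarith)]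
  exact Icc_mem_nhds (by linarith) (by linarith)

theorem contDiffOn (hV : Integrable V volume) (hs : IsOpen s) (hu : SolvesOn V E s u) :
    ContDiffOn ℝ 1 u s := by
  rw [show (1 : WithTop ℕ∞) = 0 + 1 by simp, contDiffOn_succ_iff_deriv_of_isOpen hs]
  refine ⟨fun x hx => (hu.differentiableAt x hx).differentiableWithinAt, by simp, ?_⟩
  exact contDiffOn_zero.2 (hu.continuousOn_deriv hV hs)

theorem const_mul (c : ℂ) (hu : SolvesOn V E s u) : SolvesOn V E s (fun x => c * u x) := by
  refine ⟨fun x hx => (hu.differentiableAt x hx).const_mul c, fun x y h => ?_⟩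
  rw [deriv_const_mul _ (hu.differentiableAt y (h right_mem_uIcc)),
    deriv_const_mul _ (hu.differentiableAt x (h left_mem_uIcc)), ← mul_sub, hu.deriv_sub x y h,
    ← intervalIntegral.integral_const_mul]
  exact intervalIntegral.integral_congr fun t _ => by ring

theorem add (hV : Integrable V volume) (hu : SolvesOn V E s u) (hv : SolvesOn V E s v) :
    SolvesOn V E s (fun x => u x + v x) := by
  refine ⟨fun x hx => (hu.differentiableAt x hx).add (hv.differentiableAt x hx), fun x y h => ?_⟩
  have hd : ∀ t ∈ uIcc x y, deriv (fun x => u x + v x) t = deriv u t + deriv v t := fun t ht =>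
    deriv_fun_add (hu.differentiableAt t (h ht)) (hv.differentiableAt t (h ht))
  rw [hd y right_mem_uIcc, hd x left_mem_uIcc, add_sub_add_comm, hu.deriv_sub x y h,
    hv.deriv_sub x y h, ← intervalIntegral.integral_add (hu.intervalIntegrable hV h)
      (hv.intervalIntegrable hV h)]
  exact intervalIntegral.integral_congr fun t _ => by ring

theorem congr (hs : IsOpen s) (hu : SolvesOn V E s u) (h : EqOn v u s) : SolvesOn V E s v := by
  have he : ∀ x ∈ s, v =ᶠ[𝓝 x] u := fun x hx => h.eventuallyEq_of_mem (hs.mem_nhds hx)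
  refine ⟨fun x hx => (hu.differentiableAt x hx).congr_of_eventuallyEq (he x hx),
    fun x y hxy => ?_⟩
  rw [(he y (hxy right_mem_uIcc)).deriv_eq, (he x (hxy left_mem_uIcc)).deriv_eq,
    hu.deriv_sub x y hxy]
  exact intervalIntegral.integral_congr fun t ht => by simp only [h (hxy ht)]

/-- For a real energy, complex conjugation preserves solutions. -/
theorem conj {E : ℝ} (hu : SolvesOn V E s u) :
    SolvesOn V E s (fun x => (starRingEnd ℂ) (u x)) := by
  have hd : ∀ t ∈ s, HasDerivAt (fun x => (starRingEnd ℂ) (u x)) ((starRingEnd ℂ) (deriv u t)) t :=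
    fun t ht => (hu.differentiableAt t ht).hasDerivAt.star
  refine ⟨fun x hx => (hd x hx).differentiableAt, fun x y h => ?_⟩
  rw [(hd y (h right_mem_uIcc)).deriv, (hd x (h left_mem_uIcc)).deriv, ← map_sub,
    hu.deriv_sub x y h, intervalIntegral.intervalIntegral_eq_integral_uIoc,
    intervalIntegral.intervalIntegral_eq_integral_uIoc, Complex.real_smul, map_mul,
    ← integral_conj]
  split_ifs <;> simp

theorem deriv_conj {E : ℝ} (hu : SolvesOn V E s u) {t : ℝ} (ht : t ∈ s) :
    deriv (fun x => (starRingEnd ℂ) (u x)) t = (starRingEnd ℂ) (deriv u t) :=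
  (hu.differentiableAt t ht).hasDerivAt.star.deriv

/-- The increment of `u v'` is the integral of `u' v' + (V - E) u v`, which is symmetric in `u` and
`v`, so it cancels in the Wronskian. -/
theorem wronskian_eq (hV : Integrable V volume) (hu : SolvesOn V E s u) (hv : SolvesOn V E s v)
    {x y : ℝ} (h : uIcc x y ⊆ s) : wronskian u v y = wronskian u v x := by
  have hsub : ∀ t ∈ uIcc x y, uIcc x t ⊆ s := fun t ht => (uIcc_subset_uIcc_left ht).trans h
  have key : ∀ {u v : ℝ → ℂ}, SolvesOn V E s u → SolvesOn V E s v →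
      u y * deriv v y - u x * deriv v x =
        ∫ t in x..y, (deriv u t * deriv v t + u t * (((V t : ℂ) - E) * v t)) :=
    fun hu hv => mul_sub_mul_eq_integral
      (hu.continuousOn_deriv_uIcc hV h).intervalIntegrable (hv.intervalIntegrable hV h)
      (fun t ht => hu.sub_eq_integral_deriv hV (hsub t ht))
      (fun t ht => hv.deriv_sub x t (hsub t ht))
  have e : ∫ t in x..y, (deriv u t * deriv v t + u t * (((V t : ℂ) - E) * v t)) =
      ∫ t in x..y, (deriv v t * deriv u t + v t * (((V t : ℂ) - E) * u t)) :=
    intervalIntegral.integral_congr fun t _ => by ring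
  have h1 := key hu hv
  have h2 := key hv hu
  unfold wronskian
  linear_combination h1 - h2 + e

end SolvesOn

noncomputable section Volterra

open scoped BoundedContinuousFunction

/-! ### The Volterra operator in an exponentially weighted space -/

/-- The weight `exp (l * |x - c|)`. -/
def expWeight (l c x : ℝ) : ℝ := Real.exp (l * |x - c|)

theorem expWeight_pos (l c x : ℝ) : 0 < expWeight l c x := Real.exp_pos _

theorem continuous_expWeight (l c : ℝ) : Continuous (expWeight l c) := by
  unfold expWeight; fun_prop

theorem expWeight_le_of_mem_uIoc {l c x t : ℝ} (hl : 0 ≤ l) (ht : t ∈ uIoc c x) :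
    expWeight l c t ≤ expWeight l c x := by
  have : |t - c| ≤ |x - c| := by
    rcases le_total c x with h | h
    · rw [uIoc_of_le h] at ht
      rw [abs_of_nonneg (by linarith [ht.1]), abs_of_nonneg (by linarith)]
      linarith [ht.2]
    · rw [uIoc_of_ge h] at ht
      rw [abs_of_nonpos (by linarith [ht.2]), abs_of_nonpos (by linarith)]
      linarith [ht.1]
  unfold expWeight
  gcongr

/-- The factor `1 / l` gained by integrating the weight is what makes the Volterra operator a
contraction for large `l`. -/
theorem abs_integral_expWeight_le {l : ℝ} (hl : 0 < l) (c x : ℝ) :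
    |∫ t in c..x, expWeight l c t| ≤ expWeight l c x / l := by
  have key : ∀ y : ℝ, ∫ t in (0 : ℝ)..y, Real.exp (l * t) = (Real.exp (l * y) - 1) / l := fun y => by
    rw [intervalIntegral.integral_comp_mul_left Real.exp hl.ne', integral_exp]
    simp [div_eq_inv_mul]
  have hb : ∀ y : ℝ, 0 ≤ y → |(Real.exp (l * y) - 1) / l| ≤ Real.exp (l * y) / l := fun y hy => by
    have : 1 ≤ Real.exp (l * y) := Real.one_le_exp (by positivity)
    rw [abs_of_nonneg (div_nonneg (by linarith) hl.le)]
    gcongr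
    linarith
  unfold expWeight
  rcases le_total c x with h | h
  · rw [intervalIntegral.integral_congr (g := fun t => Real.exp (l * (t - c))) fun t ht => by
      rw [uIcc_of_le h] at ht
      simp only [abs_of_nonneg (sub_nonneg.2 ht.1)]]
    rw [intervalIntegral.integral_comp_sub_right (fun t => Real.exp (l * t)), sub_self, key,
      abs_of_nonneg (sub_nonneg.2 h)]
    exact hb _ (sub_nonneg.2 h)
  · rw [intervalIntegral.integral_congr (g := fun t => Real.exp (l * (c - t))) fun t ht => by
      rw [uIcc_of_ge h] at ht
      simp only [abs_of_nonpos (sub_nonpos.2 ht.2), neg_sub]]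
    rw [intervalIntegral.integral_comp_sub_left (fun t => Real.exp (l * t)), sub_self,
      intervalIntegral.integral_symm, abs_neg, key, abs_of_nonpos (sub_nonpos.2 h), neg_sub]
    exact hb _ (sub_nonneg.2 h)

/-- `g` grows, in the integrated sense, no faster than the weight. -/
structure WeightBound (l c C : ℝ) (g : ℝ → ℂ) : Prop where
  intervalIntegrable : ∀ x y, IntervalIntegrable g volume x y
  le : ∀ x, |∫ t in c..x, ‖g t‖ * expWeight l c t| ≤ C * expWeight l c x

/-- The weight does not decrease away from `c`, so it is at most its value at the endpoint `x` and
leaves the integral. This case serves `V`; `weightBound_one` serves the energy term. -/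
theorem weightBound_of_integrable {l : ℝ} (hl : 0 ≤ l) (c : ℝ) {g : ℝ → ℂ} (hg : Integrable g) :
    WeightBound l c (∫ t, ‖g t‖) g := by
  refine ⟨fun _ _ => hg.intervalIntegrable, fun x => ?_⟩
  rw [← Real.norm_eq_abs]
  calc ‖∫ t in c..x, ‖g t‖ * expWeight l c t‖
      ≤ ∫ t in uIoc c x, ‖‖g t‖ * expWeight l c t‖ :=
        intervalIntegral.norm_integral_le_integral_norm_uIoc
    _ ≤ ∫ t in uIoc c x, ‖g t‖ * expWeight l c x := by
        refine setIntegral_mono_on ?_ (hg.norm.mul_const _).integrableOn measurableSet_uIoc ?_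
        · exact ((hg.norm.intervalIntegrable (a := c) (b := x)).mul_continuousOn
            (continuous_expWeight l c).continuousOn).def'.norm
        · intro t ht
          rw [norm_mul, norm_norm, Real.norm_of_nonneg (expWeight_pos l c t).le]
          exact mul_le_mul_of_nonneg_left (expWeight_le_of_mem_uIoc hl ht) (norm_nonneg _)
    _ = (∫ t in uIoc c x, ‖g t‖) * expWeight l c x := integral_mul_const _ _
    _ ≤ _ := by
        refine mul_le_mul_of_nonneg_right ?_ (expWeight_pos l c x).le
        exact setIntegral_le_integral hg.norm (Eventually.of_forall fun _ => norm_nonneg _)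

theorem weightBound_one {l : ℝ} (hl : 1 ≤ l) (c : ℝ) : WeightBound l c 1 (fun _ => 1) := by
  refine ⟨fun _ _ => continuous_const.intervalIntegrable _ _, fun x => ?_⟩
  simp only [norm_one, one_mul]
  refine (abs_integral_expWeight_le (by linarith) c x).trans ?_
  exact div_le_self (expWeight_pos l c x).le hl

namespace WeightBound

variable {l c C : ℝ} {g : ℝ → ℂ}

theorem intervalIntegrable_mul (hg : WeightBound l c C g) (v : ℝ →ᵇ ℂ) (x y : ℝ) :
    IntervalIntegrable (fun t => g t * (expWeight l c t * v t)) volume x y :=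
  (hg.intervalIntegrable x y).mul_continuousOn
    ((Complex.continuous_ofReal.comp (continuous_expWeight l c)).mul v.continuous).continuousOn

theorem norm_integral_le (hg : WeightBound l c C g) (v : ℝ →ᵇ ℂ) (x : ℝ) :
    ‖∫ t in c..x, g t * (expWeight l c t * v t)‖ ≤ C * expWeight l c x * ‖v‖ := by
  have hi : IntervalIntegrable (fun t => ‖g t‖ * expWeight l c t) volume c x :=
    (hg.intervalIntegrable c x).norm.mul_continuousOn (continuous_expWeight l c).continuousOn
  calc ‖∫ t in c..x, g t * (expWeight l c t * v t)‖
      ≤ |∫ t in c..x, ‖g t‖ * expWeight l c t * ‖v‖| := by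
        refine intervalIntegral.norm_integral_le_abs_of_norm_le
          (Eventually.of_forall fun t => ?_) (hi.mul_const _)
        rw [norm_mul, norm_mul, Complex.norm_real, Real.norm_of_nonneg (expWeight_pos l c t).le,
          ← mul_assoc]
        exact mul_le_mul_of_nonneg_left (v.norm_coe_le_norm t)
          (mul_nonneg (norm_nonneg _) (expWeight_pos l c t).le)
    _ = |∫ t in c..x, ‖g t‖ * expWeight l c t| * ‖v‖ := by
        rw [intervalIntegral.integral_mul_const, abs_mul, abs_norm]
    _ ≤ _ := mul_le_mul_of_nonneg_right (hg.le x) (norm_nonneg _)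

/-- The functional `v ↦ ∫_c^x g v` on the weighted space. -/
def primitive (hg : WeightBound l c C g) (x : ℝ) : (ℝ →ᵇ ℂ) →L[ℂ] ℂ :=
  LinearMap.mkContinuous
    { toFun := fun v => ∫ t in c..x, g t * (expWeight l c t * v t)
      map_add' := fun v₁ v₂ => by
        rw [← intervalIntegral.integral_add (hg.intervalIntegrable_mul v₁ c x)
          (hg.intervalIntegrable_mul v₂ c x)]
        exact intervalIntegral.integral_congr fun t _ => by
          simp only [BoundedContinuousFunction.coe_add, Pi.add_apply]; ring
      map_smul' := fun r v => by
        rw [RingHom.id_apply, smul_eq_mul, ← intervalIntegral.integral_const_mul]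
        exact intervalIntegral.integral_congr fun t _ => by
          simp only [BoundedContinuousFunction.coe_smul, smul_eq_mul]; ring }
    (C * expWeight l c x) (hg.norm_integral_le · x)

theorem primitive_apply (hg : WeightBound l c C g) (x : ℝ) (v : ℝ →ᵇ ℂ) :
    hg.primitive x v = ∫ t in c..x, g t * (expWeight l c t * v t) := rfl

theorem continuous_primitive (hg : WeightBound l c C g) (v : ℝ →ᵇ ℂ) :
    Continuous fun x => hg.primitive x v :=
  intervalIntegral.continuous_primitive (hg.intervalIntegrable_mul v) c

/-- The inner integration costs the factor `C`, the outer one gains `1 / l`. -/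
theorem norm_integral_primitive_le (hl : 0 < l) (hg : WeightBound l c C g) (v : ℝ →ᵇ ℂ) (x : ℝ) :
    ‖((expWeight l c x)⁻¹ : ℂ) * ∫ t in c..x, hg.primitive t v‖ ≤ C / l * ‖v‖ := by
  have hC : 0 ≤ C := by
    have := (abs_nonneg _).trans (hg.le c)
    exact nonneg_of_mul_nonneg_left this (expWeight_pos l c c)
  have h1 : ‖∫ t in c..x, hg.primitive t v‖ ≤ C * ‖v‖ * (expWeight l c x / l) := by
    calc ‖∫ t in c..x, hg.primitive t v‖ ≤ |∫ t in c..x, C * ‖v‖ * expWeight l c t| := by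
          refine intervalIntegral.norm_integral_le_abs_of_norm_le
            (Eventually.of_forall fun t => ?_)
            ((continuous_const.mul (continuous_expWeight l c)).intervalIntegrable _ _)
          exact (hg.norm_integral_le v t).trans_eq (by ring)
      _ = C * ‖v‖ * |∫ t in c..x, expWeight l c t| := by
          rw [intervalIntegral.integral_const_mul, abs_mul, abs_of_nonneg (by positivity)]
      _ ≤ _ := mul_le_mul_of_nonneg_left (abs_integral_expWeight_le hl c x) (by positivity)
  have hw := expWeight_pos l c x
  rw [norm_mul, norm_inv, Complex.norm_real, Real.norm_of_nonneg hw.le]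
  refine (mul_le_mul_of_nonneg_left h1 (by positivity)).trans_eq ?_
  field_simp

/-- The Volterra operator `v ↦ w⁻¹ ∫_c^x ∫_c^t g w v`, where `w` is the weight. -/
def volterra (hl : 0 < l) (hg : WeightBound l c C g) : (ℝ →ᵇ ℂ) →L[ℂ] (ℝ →ᵇ ℂ) :=
  LinearMap.mkContinuous
    { toFun := fun v => BoundedContinuousFunction.ofNormedAddCommGroup
        (fun x => ((expWeight l c x)⁻¹ : ℂ) * ∫ t in c..x, hg.primitive t v)
        (((Complex.continuous_ofReal.comp (continuous_expWeight l c)).inv₀ fun x =>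
            Complex.ofReal_ne_zero.2 (expWeight_pos l c x).ne').mul
          (intervalIntegral.continuous_primitive
            (fun x y => (hg.continuous_primitive v).intervalIntegrable x y) c))
        (C / l * ‖v‖) (hg.norm_integral_primitive_le hl v)
      map_add' := fun v₁ v₂ => by
        ext x
        simp only [BoundedContinuousFunction.coe_ofNormedAddCommGroup, map_add,
          BoundedContinuousFunction.coe_add, Pi.add_apply]
        rw [intervalIntegral.integral_add ((hg.continuous_primitive v₁).intervalIntegrable _ _)
          ((hg.continuous_primitive v₂).intervalIntegrable _ _), mul_add]
      map_smul' := fun r v => by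
        ext x
        simp only [BoundedContinuousFunction.coe_ofNormedAddCommGroup, map_smul, RingHom.id_apply,
          BoundedContinuousFunction.coe_smul, smul_eq_mul, intervalIntegral.integral_const_mul]
        ring }
    (C / l) fun v => by
      have h0 : 0 ≤ C / l * ‖v‖ := (norm_nonneg _).trans (hg.norm_integral_primitive_le hl v 0)
      exact BoundedContinuousFunction.norm_ofNormedAddCommGroup_le _ h0
        (hg.norm_integral_primitive_le hl v)

theorem volterra_apply (hl : 0 < l) (hg : WeightBound l c C g) (v : ℝ →ᵇ ℂ) (x : ℝ) :
    hg.volterra hl v x = ((expWeight l c x)⁻¹ : ℂ) * ∫ t in c..x, hg.primitive t v := rfl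

theorem norm_volterra_le (hl : 0 < l) (hg : WeightBound l c C g) :
    ‖hg.volterra hl‖ ≤ C / l := by
  refine LinearMap.mkContinuous_norm_le _ (div_nonneg ?_ hl.le) _
  exact nonneg_of_mul_nonneg_left ((abs_nonneg _).trans (hg.le c)) (expWeight_pos l c c)

end WeightBound

end Volterra

open scoped BoundedContinuousFunction

/-! ### Existence, uniqueness and continuous dependence for the initial value problem -/

/-- These carry the initial data: `u(c) f₁ + u'(c) f₂` is the affine part of the integral equation,
divided by the weight. -/
theorem exists_weighted_affine {l : ℝ} (hl : 1 ≤ l) (c : ℝ) : ∃ f₁ f₂ : ℝ →ᵇ ℂ,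
    (∀ x, f₁ x = (expWeight l c x : ℂ)⁻¹) ∧ ∀ x, f₂ x = (expWeight l c x : ℂ)⁻¹ * (x - c : ℝ) := by
  have hcont : Continuous fun x => (expWeight l c x : ℂ)⁻¹ :=
    (Complex.continuous_ofReal.comp (continuous_expWeight l c)).inv₀ fun x =>
      Complex.ofReal_ne_zero.2 (expWeight_pos l c x).ne'
  refine ⟨.ofNormedAddCommGroup _ hcont 1 fun x => ?_, .ofNormedAddCommGroup
    (fun x => (expWeight l c x : ℂ)⁻¹ * (x - c : ℝ)) (hcont.mul (by fun_prop)) 1 fun x => ?_,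
    fun _ => rfl, fun _ => rfl⟩
  · rw [norm_inv, Complex.norm_real, Real.norm_of_nonneg (expWeight_pos l c x).le]
    exact inv_le_one_of_one_le₀ (Real.one_le_exp (by positivity))
  · rw [norm_mul, norm_inv, Complex.norm_real, Real.norm_of_nonneg (expWeight_pos l c x).le,
      Complex.norm_real, Real.norm_eq_abs, inv_mul_le_one₀ (expWeight_pos l c x)]
    have h1 : |x - c| ≤ l * |x - c| := le_mul_of_one_le_left (abs_nonneg _) hl
    have h2 := Real.add_one_le_exp (l * |x - c|)
    unfold expWeight
    linarith

/-- The initial value problem has a solution depending continuously on the energy and on the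
initial values `z = (E, u c, u' c)`, as long as the energy stays bounded. -/
theorem exists_solution_family {V : ℝ → ℝ} (hV : Integrable V volume) (c R : ℝ) :
    ∃ S : ℂ × ℂ × ℂ → ℝ → ℂ,
      (∀ z, ‖z.1‖ < R → SolvesOn V z.1 univ (S z) ∧ S z c = z.2.1 ∧ deriv (S z) c = z.2.2) ∧
      ∀ x, ContinuousOn (fun z => S z x) {z | ‖z.1‖ < R} ∧
        ContinuousOn (fun z => deriv (S z) x) {z | ‖z.1‖ < R} := by
  set K : ℝ := ∫ t, ‖(V t : ℂ)‖ with hK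
  have hK0 : 0 ≤ K := integral_nonneg fun _ => norm_nonneg _
  -- The operators for `V` and for the energy have norms at most `K / l` and `R / l`; this `l`
  -- exceeds `K + R`.
  set l : ℝ := K + |R| + 1 with hl
  have hl1 : 1 ≤ l := by rw [hl]; linarith [abs_nonneg R]
  have hl0 : 0 < l := by linarith
  have bV : WeightBound l c K (fun t => (V t : ℂ)) := weightBound_of_integrable hl0.le c hV.ofReal
  have b1 := weightBound_one hl1 c
  obtain ⟨f₁, f₂, hf₁, hf₂⟩ := exists_weighted_affine hl1 c
  set T : ℂ × ℂ × ℂ → ((ℝ →ᵇ ℂ) →L[ℂ] (ℝ →ᵇ ℂ)) :=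
    fun z => bV.volterra hl0 - z.1 • b1.volterra hl0 with hT
  have hTc : Continuous T := continuous_const.sub (continuous_fst.smul continuous_const)
  have hTn : ∀ z, ‖z.1‖ < R → ‖T z‖ < 1 := by
    intro z hz
    calc ‖T z‖ ≤ ‖bV.volterra hl0‖ + ‖z.1 • b1.volterra hl0‖ := norm_sub_le _ _
      _ ≤ K / l + R * (1 / l) := by
          rw [norm_smul]
          have := b1.norm_volterra_le hl0
          have h2 := bV.norm_volterra_le hl0
          have h3 : 0 ≤ R := (norm_nonneg _).trans hz.le
          gcongr
      _ = (K + R) / l := by ring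
      _ < 1 := by
          rw [div_lt_one hl0, hl]
          linarith [le_abs_self R]
  have hunit : ∀ z, ‖z.1‖ < R → IsUnit (1 - T z) := fun z hz =>
    isUnit_one_sub_of_norm_lt_one (R := (ℝ →ᵇ ℂ) →L[ℂ] (ℝ →ᵇ ℂ)) (hTn z hz)
  -- `v` is the solution divided by the weight. Its continuity in `z` is that of inversion at a
  -- unit, `T` being affine in the energy.
  set v : ℂ × ℂ × ℂ → (ℝ →ᵇ ℂ) :=
    fun z => Ring.inverse (1 - T z) (z.2.1 • f₁ + z.2.2 • f₂) with hv
  have hvc : ContinuousOn v {z | ‖z.1‖ < R} := by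
    intro z hz
    have h1 : ContinuousAt (fun z => Ring.inverse (1 - T z)) z := by
      obtain ⟨U, hU⟩ := hunit z hz
      have h2 := NormedRing.inverse_continuousAt (R := (ℝ →ᵇ ℂ) →L[ℂ] (ℝ →ᵇ ℂ)) U
      rw [hU] at h2
      exact ContinuousAt.comp (f := fun z => 1 - T z) h2 (continuous_const.sub hTc).continuousAt
    have h3 : Continuous fun z : ℂ × ℂ × ℂ => z.2.1 • f₁ + z.2.2 • f₂ := by fun_prop
    exact (h1.clm_apply h3.continuousAt).continuousWithinAt
  have hveq : ∀ z, ‖z.1‖ < R → v z = z.2.1 • f₁ + z.2.2 • f₂ + T z (v z) := by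
    intro z hz
    have h1 : (1 - T z) (v z) = z.2.1 • f₁ + z.2.2 • f₂ := by
      rw [hv, ← mul_apply_eq_comp, Ring.mul_inverse_cancel _ (hunit z hz)]
      rfl
    rw [← h1]
    simp
  set S : ℂ × ℂ × ℂ → ℝ → ℂ := fun z x => expWeight l c x * v z x with hS
  -- `D z` is the candidate for the derivative of `S z`: the once integrated equation.
  set D : ℂ × ℂ × ℂ → ℝ → ℂ :=
    fun z x => z.2.2 + (bV.primitive x (v z) - z.1 * b1.primitive x (v z)) with hD
  have hDc : ∀ z, Continuous (D z) := fun z => continuous_const.add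
    ((bV.continuous_primitive _).sub (continuous_const.mul (b1.continuous_primitive _)))
  have hSeq : ∀ z, ‖z.1‖ < R → ∀ x, S z x = z.2.1 + ∫ t in c..x, D z t := by
    intro z hz x
    have hw : (expWeight l c x : ℂ) ≠ 0 := Complex.ofReal_ne_zero.2 (expWeight_pos l c x).ne'
    have iV := (bV.continuous_primitive (v z)).intervalIntegrable (μ := volume) c x
    have i1 := (b1.continuous_primitive (v z)).intervalIntegrable (μ := volume) c x
    rw [hS, hD]
    simp only
    rw [intervalIntegral.integral_add (by simp) (iV.sub (i1.const_mul _)),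
      intervalIntegral.integral_sub iV (i1.const_mul _), intervalIntegral.integral_const_mul,
      intervalIntegral.integral_const, congrArg (fun f : ℝ →ᵇ ℂ => f x) (hveq z hz)]
    simp only [hT, BoundedContinuousFunction.coe_add, BoundedContinuousFunction.coe_smul,
      Pi.add_apply, sub_apply, smul_apply,
      BoundedContinuousFunction.coe_sub, Pi.sub_apply, WeightBound.volterra_apply, hf₁, hf₂,
      smul_eq_mul, Complex.real_smul]
    field_simp
    ring
  have hder : ∀ z, ‖z.1‖ < R → ∀ x, HasDerivAt (S z) (D z x) x := by
    intro z hz x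
    rw [funext (hSeq z hz)]
    exact (intervalIntegral.integral_hasDerivAt_right ((hDc z).intervalIntegrable _ _)
      ((hDc z).stronglyMeasurableAtFilter _ _) (hDc z).continuousAt).const_add _
  refine ⟨S, fun z hz => ⟨⟨fun x _ => (hder z hz x).differentiableAt, fun x y _ => ?_⟩, ?_, ?_⟩,
    fun x => ⟨?_, ?_⟩⟩
  · rw [(hder z hz y).deriv, (hder z hz x).deriv]
    have hi := fun y => bV.intervalIntegrable_mul (v z) c y
    have hi1 := fun y => b1.intervalIntegrable_mul (v z) c y
    have e1 := intervalIntegral.integral_interval_sub_left (hi y) (hi x)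
    have e2 := intervalIntegral.integral_interval_sub_left (hi1 y) (hi1 x)
    have e3 : ∫ t in x..y, ((V t : ℂ) - z.1) * S z t =
        (∫ t in x..y, (V t : ℂ) * (expWeight l c t * v z t)) -
          z.1 * ∫ t in x..y, 1 * (expWeight l c t * v z t) := by
      rw [← intervalIntegral.integral_const_mul, ← intervalIntegral.integral_sub
        (bV.intervalIntegrable_mul (v z) x y) ((b1.intervalIntegrable_mul (v z) x y).const_mul _)]
      exact intervalIntegral.integral_congr fun t _ => by simp only [hS]; ring
    rw [e3, ← e1, ← e2]
    simp only [hD, WeightBound.primitive_apply]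
    ring
  · simp [hSeq z hz c]
  · rw [(hder z hz c).deriv]
    simp [hD, WeightBound.primitive_apply]
  · exact continuousOn_const.mul fun z hz =>
      ((continuous_eval_const x).tendsto (v z)).comp (hvc z hz)
  · have : ContinuousOn (fun z => D z x) {z | ‖z.1‖ < R} := by
      have h1 : ContinuousOn (fun z => bV.primitive x (v z)) {z | ‖z.1‖ < R} :=
        (bV.primitive x).continuous.comp_continuousOn hvc
      have h2 : ContinuousOn (fun z => b1.primitive x (v z)) {z | ‖z.1‖ < R} :=
        (b1.primitive x).continuous.comp_continuousOn hvc
      exact continuous_snd.snd.continuousOn.add (h1.sub (continuous_fst.continuousOn.mul h2))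
    exact this.congr fun z hz => (hder z hz x).deriv

theorem exists_solution {V : ℝ → ℝ} (hV : Integrable V volume) (E : ℂ) (c : ℝ) (p q : ℂ) :
    ∃ u, SolvesOn V E univ u ∧ u c = p ∧ deriv u c = q := by
  obtain ⟨S, h, -⟩ := exists_solution_family hV c (‖E‖ + 1)
  exact ⟨_, h (E, p, q) (by simp)⟩

/-- A solution is determined by its value and its derivative at one point. -/
theorem SolvesOn.eq_of_initial {V : ℝ → ℝ} (hV : Integrable V volume) {E : ℂ} {s : Set ℝ}
    {u v : ℝ → ℂ} (hu : SolvesOn V E s u) (hv : SolvesOn V E s v) {c x : ℝ} (h : uIcc c x ⊆ s)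
    (h0 : u c = v c) (h1 : deriv u c = deriv v c) : u x = v x ∧ deriv u x = deriv v x := by
  obtain ⟨φ, hφ, hφ0, hφ1⟩ := exists_solution hV E c 1 0
  obtain ⟨χ, hχ, hχ0, hχ1⟩ := exists_solution hV E c 0 1
  -- Cramer's rule: the Wronskians of `u` and `v` with `φ` and `χ` agree at `c`, hence at `x`, and
  -- they determine value and derivative there because `φ` and `χ` have Wronskian `1`.
  have e1 := (hu.wronskian_eq hV (hφ.mono (subset_univ s)) h)
  have e2 := (hv.wronskian_eq hV (hφ.mono (subset_univ s)) h)
  have e3 := (hu.wronskian_eq hV (hχ.mono (subset_univ s)) h)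
  have e4 := (hv.wronskian_eq hV (hχ.mono (subset_univ s)) h)
  have e5 := (hφ.wronskian_eq hV hχ (subset_univ (uIcc c x)))
  simp only [wronskian, hφ0, hφ1, hχ0, hχ1, h0, h1] at e1 e2 e3 e4 e5
  constructor
  · linear_combination (-(u x - v x)) * e5 + φ x * (e3 - e4) - χ x * (e1 - e2)
  · linear_combination (-(deriv u x - deriv v x)) * e5 + deriv φ x * (e3 - e4) -
      deriv χ x * (e1 - e2)

/-! ### Jost solutions -/

/-- The exceptional set is null near each of its points, hence null by second countability. -/
theorem ae_eq_zero_of_notMem_essSupport (V : ℝ → ℝ) : ∀ᵐ x, x ∉ essSupport V → V x = 0 := by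
  rw [ae_iff]
  refine measure_null_of_locally_null _ fun x hx => ?_
  obtain ⟨hx, -⟩ := Classical.not_imp.1 hx
  simp only [essSupport, mem_ofPred_eq, not_forall, not_not] at hx
  obtain ⟨U, hU, hV⟩ := hx
  obtain ⟨W, hWU, hW, hxW⟩ := mem_nhds_iff.1 hU
  refine ⟨_, inter_mem_nhdsWithin _ (hW.mem_nhds hxW), ?_⟩
  have h := ae_restrict_of_ae_restrict_of_subset hWU hV
  have h := ae_iff.1 ((ae_restrict_iff' hW.measurableSet).1 h)
  refine measure_mono_null (fun y hy => ?_) h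
  exact fun h0 => hy.1 fun _ => h0 hy.2

theorem ae_eq_zero_Ici {V : ℝ → ℝ} {a b : ℝ} (h : essSupport V = Icc a b) :
    ∀ᵐ x, x ∈ Ici b → V x = 0 := by
  filter_upwards [ae_eq_zero_of_notMem_essSupport V, Measure.ae_ne volume b] with x hx hb hxb
  exact hx fun hx' => hb (le_antisymm (h ▸ hx').2 hxb)

theorem ae_eq_zero_Iic {V : ℝ → ℝ} {a b : ℝ} (h : essSupport V = Icc a b) :
    ∀ᵐ x, x ∈ Iic a → V x = 0 := by
  filter_upwards [ae_eq_zero_of_notMem_essSupport V, Measure.ae_ne volume a] with x hx ha hxa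
  exact hx fun hx' => ha (le_antisymm hxa (h ▸ hx').1)

theorem hasDerivAt_cexp_mul (κ : ℂ) (x : ℝ) :
    HasDerivAt (fun x : ℝ => Complex.exp (κ * x)) (κ * Complex.exp (κ * x)) x := by
  have h := ((Complex.ofRealCLM.hasDerivAt (x := x)).const_mul κ).cexp
  simpa [mul_comm] using h

theorem solvesOn_cexp {V : ℝ → ℝ} {s : Set ℝ} (hs : ∀ᵐ t, t ∈ s → V t = 0) {κ E : ℂ}
    (hκ : κ ^ 2 = -E) : SolvesOn V E s (fun x : ℝ => Complex.exp (κ * x)) := by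
  refine ⟨fun x _ => (hasDerivAt_cexp_mul κ x).differentiableAt, fun x y h => ?_⟩
  rw [(hasDerivAt_cexp_mul κ x).deriv, (hasDerivAt_cexp_mul κ y).deriv,
    ← intervalIntegral.integral_eq_sub_of_hasDerivAt (f := fun x : ℝ => κ * Complex.exp (κ * x))
      (fun t _ => (hasDerivAt_cexp_mul κ t).const_mul κ)
      (Continuous.intervalIntegrable (by fun_prop) _ _)]
  refine intervalIntegral.integral_congr_ae ?_
  filter_upwards [hs] with t ht hxy
  rw [ht (h (uIoc_subset_uIcc hxy)), ← mul_assoc, ← pow_two, hκ]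
  simp

/-- Start the initial value problem at `c` with the data of the exponential; uniqueness keeps the
two equal throughout `s`. -/
theorem exists_cexp_continuation {V : ℝ → ℝ} (hV : Integrable V volume) {s : Set ℝ}
    [s.OrdConnected] (hs : ∀ᵐ t, t ∈ s → V t = 0) {c : ℝ} (hc : c ∈ s) {κ E : ℂ}
    (hκ : κ ^ 2 = -E) :
    ∃ u, SolvesOn V E univ u ∧ ∀ x ∈ s, u x = Complex.exp (κ * x) := by
  obtain ⟨u, hu, h0, h1⟩ := exists_solution hV E c (Complex.exp (κ * c)) (κ * Complex.exp (κ * c))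
  refine ⟨u, hu, fun x hx => ?_⟩
  exact ((hu.mono (subset_univ s)).eq_of_initial hV (solvesOn_cexp hs hκ)
    (OrdConnected.uIcc_subset ‹_› hc hx) h0 (h1.trans (hasDerivAt_cexp_mul κ c).deriv.symm)).1

/-- The Jost solutions are prescribed on open half-lines only; being `C¹`, they keep the
exponential's data at the endpoint, where the later computations need them. -/
theorem eq_cexp_of_mem_closure {V : ℝ → ℝ} (hV : Integrable V volume) {E κ : ℂ} {s : Set ℝ}
    (hs : IsOpen s) {u : ℝ → ℂ} (hu : SolvesOn V E univ u)
    (h : ∀ x ∈ s, u x = Complex.exp (κ * x)) {x : ℝ} (hx : x ∈ closure s) :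
    u x = Complex.exp (κ * x) ∧ deriv u x = κ * Complex.exp (κ * x) := by
  have hc : Continuous u := continuousOn_univ.1 hu.continuousOn
  have hd : Continuous (deriv u) := continuousOn_univ.1 (hu.continuousOn_deriv hV isOpen_univ)
  constructor
  · exact EqOn.closure (g := fun x : ℝ => Complex.exp (κ * x)) h hc (by fun_prop) hx
  · refine EqOn.closure (g := fun x : ℝ => κ * Complex.exp (κ * x)) (fun y hy => ?_) hd
      (by fun_prop) hx
    have he : u =ᶠ[𝓝 y] fun x : ℝ => Complex.exp (κ * x) :=
      EqOn.eventuallyEq_of_mem h (hs.mem_nhds hy)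
    rw [he.deriv_eq, (hasDerivAt_cexp_mul κ y).deriv]

/-- Solutions whose initial values at `c` depend continuously on the momentum depend continuously
on the momentum. -/
theorem continuous_of_continuous_initial {V : ℝ → ℝ} (hV : Integrable V volume) {F : ℂ → ℝ → ℂ}
    (hF : ∀ ζ, SolvesOn V (ζ ^ 2) univ (F ζ)) {c : ℝ} (h0 : Continuous fun ζ => F ζ c)
    (h1 : Continuous fun ζ => deriv (F ζ) c) (x : ℝ) :
    Continuous (fun ζ => F ζ x) ∧ Continuous fun ζ => deriv (F ζ) x := by
  have key : ∀ ζ₀, ContinuousAt (fun ζ => F ζ x) ζ₀ ∧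
      ContinuousAt (fun ζ => deriv (F ζ) x) ζ₀ := by
    intro ζ₀
    -- The family covers bounded energies only, so continuity is proved near one momentum at a time.
    obtain ⟨S, hS, hSc⟩ := exists_solution_family hV c (‖ζ₀ ^ 2‖ + 1)
    set z : ℂ → ℂ × ℂ × ℂ := fun ζ => (ζ ^ 2, F ζ c, deriv (F ζ) c) with hz
    have hzc : Continuous z := by fun_prop
    have hopen : IsOpen {z : ℂ × ℂ × ℂ | ‖z.1‖ < ‖ζ₀ ^ 2‖ + 1} :=
      isOpen_lt (by fun_prop) continuous_const
    have hmem : {z : ℂ × ℂ × ℂ | ‖z.1‖ < ‖ζ₀ ^ 2‖ + 1} ∈ 𝓝 (z ζ₀) :=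
      hopen.mem_nhds (by simp [hz])
    have heq : ∀ᶠ ζ in 𝓝 ζ₀, S (z ζ) x = F ζ x ∧ deriv (S (z ζ)) x = deriv (F ζ) x := by
      filter_upwards [hzc.continuousAt.preimage_mem_nhds hmem] with ζ hζ
      obtain ⟨s1, s2, s3⟩ := hS (z ζ) hζ
      exact s1.eq_of_initial hV (hF ζ) (subset_univ _) s2 s3
    exact ⟨((((hSc x).1.continuousAt hmem).comp (f := z) hzc.continuousAt)).congr
        (heq.mono fun _ h => h.1),
      ((((hSc x).2.continuousAt hmem).comp (f := z) hzc.continuousAt)).congr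
        (heq.mono fun _ h => h.2)⟩
  exact ⟨continuous_iff_continuousAt.2 fun ζ => (key ζ).1,
    continuous_iff_continuousAt.2 fun ζ => (key ζ).2⟩

section Jost

variable {V : ℝ → ℝ} {a b : ℝ}

theorem isJostPlus_jostPlus (hV : Integrable V volume) (hs : essSupport V = Icc a b) (ζ : ℂ) :
    IsJostPlus V b ζ (jostPlus V b ζ) := by
  refine Classical.epsilon_spec (p := IsJostPlus V b ζ) ?_
  obtain ⟨u, hu, h⟩ := exists_cexp_continuation hV (ae_eq_zero_Ici hs) self_mem_Ici
    (κ := Complex.I * ζ) (E := ζ ^ 2) (by rw [mul_pow, Complex.I_sq]; ring)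
  exact ⟨u, hu, fun x hx => h x hx.le⟩

theorem isJostMinus_jostMinus (hV : Integrable V volume) (hs : essSupport V = Icc a b) (ζ : ℂ) :
    IsJostMinus V a ζ (jostMinus V a ζ) := by
  refine Classical.epsilon_spec (p := IsJostMinus V a ζ) ?_
  obtain ⟨u, hu, h⟩ := exists_cexp_continuation hV (ae_eq_zero_Iic hs) self_mem_Iic
    (κ := -(Complex.I * ζ)) (E := ζ ^ 2) (by rw [neg_sq, mul_pow, Complex.I_sq]; ring)
  exact ⟨u, hu, fun x hx => by rw [h x hx.le, neg_mul]⟩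

theorem solvesOn_jostPlus (hV : Integrable V volume) (hs : essSupport V = Icc a b) (ζ : ℂ) :
    SolvesOn V (ζ ^ 2) univ (jostPlus V b ζ) := (isJostPlus_jostPlus hV hs ζ).1

theorem solvesOn_jostMinus (hV : Integrable V volume) (hs : essSupport V = Icc a b) (ζ : ℂ) :
    SolvesOn V (ζ ^ 2) univ (jostMinus V a ζ) := (isJostMinus_jostMinus hV hs ζ).1

theorem jostPlus_of_le (hV : Integrable V volume) (hs : essSupport V = Icc a b) (ζ : ℂ) {x : ℝ}
    (hx : b ≤ x) : jostPlus V b ζ x = Complex.exp (Complex.I * ζ * x) ∧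
      deriv (jostPlus V b ζ) x = Complex.I * ζ * Complex.exp (Complex.I * ζ * x) :=
  eq_cexp_of_mem_closure hV isOpen_Ioi (solvesOn_jostPlus hV hs ζ) (isJostPlus_jostPlus hV hs ζ).2
    (by rwa [closure_Ioi])

theorem jostMinus_of_le (hV : Integrable V volume) (hs : essSupport V = Icc a b) (ζ : ℂ) {x : ℝ}
    (hx : x ≤ a) : jostMinus V a ζ x = Complex.exp (-(Complex.I * ζ * x)) ∧
      deriv (jostMinus V a ζ) x = -(Complex.I * ζ) * Complex.exp (-(Complex.I * ζ * x)) := by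
  rw [← neg_mul]
  exact eq_cexp_of_mem_closure hV isOpen_Iio (solvesOn_jostMinus hV hs ζ)
    (fun x hx => by rw [neg_mul, (isJostMinus_jostMinus hV hs ζ).2 x hx]) (by rwa [closure_Iio])

theorem continuous_jostPlus (hV : Integrable V volume) (hs : essSupport V = Icc a b) (x : ℝ) :
    Continuous (fun ζ => jostPlus V b ζ x) ∧ Continuous fun ζ => deriv (jostPlus V b ζ) x := by
  refine continuous_of_continuous_initial hV (solvesOn_jostPlus hV hs) (c := b) ?_ ?_ x
  · simp_rw [(jostPlus_of_le hV hs _ le_rfl).1]; fun_prop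
  · simp_rw [(jostPlus_of_le hV hs _ le_rfl).2]; fun_prop

theorem continuous_jostMinus (hV : Integrable V volume) (hs : essSupport V = Icc a b) (x : ℝ) :
    Continuous (fun ζ => jostMinus V a ζ x) ∧ Continuous fun ζ => deriv (jostMinus V a ζ) x := by
  refine continuous_of_continuous_initial hV (solvesOn_jostMinus hV hs) (c := a) ?_ ?_ x
  · simp_rw [(jostMinus_of_le hV hs _ le_rfl).1]; fun_prop
  · simp_rw [(jostMinus_of_le hV hs _ le_rfl).2]; fun_prop

theorem continuous_jostFunction (hV : Integrable V volume) (hs : essSupport V = Icc a b) :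
    Continuous (jostFunction V a b) :=
  ((continuous_jostPlus hV hs a).1.mul (continuous_jostMinus hV hs a).2).sub
    ((continuous_jostPlus hV hs a).2.mul (continuous_jostMinus hV hs a).1)

theorem jostFunction_eq (hV : Integrable V volume) (hs : essSupport V = Icc a b) (ζ : ℂ) (x : ℝ) :
    jostPlus V b ζ x * deriv (jostMinus V a ζ) x - deriv (jostPlus V b ζ) x * jostMinus V a ζ x =
      jostFunction V a b ζ :=
  (solvesOn_jostPlus hV hs ζ).wronskian_eq hV (solvesOn_jostMinus hV hs ζ) (subset_univ (uIcc a x))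

/-- Any solution is a combination of the Jost solutions, the coefficients being Wronskians. -/
theorem SolvesOn.mul_jostFunction_eq (hV : Integrable V volume) (hs : essSupport V = Icc a b)
    {ζ : ℂ} {s : Set ℝ} {u : ℝ → ℂ} (hu : SolvesOn V (ζ ^ 2) s u) {c x : ℝ} (h : uIcc c x ⊆ s) :
    u x * jostFunction V a b ζ = wronskian u (jostMinus V a ζ) c * jostPlus V b ζ x -
      wronskian u (jostPlus V b ζ) c * jostMinus V a ζ x := by
  rw [← hu.wronskian_eq hV ((solvesOn_jostMinus hV hs ζ).mono (subset_univ s)) h,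
    ← hu.wronskian_eq hV ((solvesOn_jostPlus hV hs ζ).mono (subset_univ s)) h,
    ← jostFunction_eq hV hs ζ x, wronskian, wronskian]
  ring

end Jost

/-! ### The Jost function on the real line -/

/-- Flux conservation: at real energy `ū` is a solution too, and the Wronskian of `u` and `ū` is
`-2i Im (u' ū)`. -/
theorem SolvesOn.im_deriv_mul_conj_eq {V : ℝ → ℝ} (hV : Integrable V volume) {E : ℝ} {u : ℝ → ℂ}
    (hu : SolvesOn V E univ u) (x y : ℝ) :
    (deriv u y * (starRingEnd ℂ) (u y)).im = (deriv u x * (starRingEnd ℂ) (u x)).im := by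
  have h := hu.wronskian_eq hV hu.conj (subset_univ (uIcc x y))
  simp only [wronskian, hu.deriv_conj (mem_univ _)] at h
  have h' := congrArg Complex.im h
  simp only [Complex.sub_im, Complex.mul_im, Complex.conj_re, Complex.conj_im] at h' ⊢
  linarith

section JostReal

variable {V : ℝ → ℝ} {a b : ℝ}

theorem norm_exp_I_mul (k x : ℝ) : ‖Complex.exp (Complex.I * k * x)‖ = 1 := by
  rw [mul_assoc, mul_comm, ← Complex.ofReal_mul, Complex.norm_exp_ofReal_mul_I]

theorem norm_exp_neg_I_mul (k x : ℝ) : ‖Complex.exp (-(Complex.I * k * x))‖ = 1 := by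
  rw [Complex.exp_neg, norm_inv, norm_exp_I_mul, inv_one]

/-- At `a` the function `χ₋` is explicit, so `|w| = |i k χ₊(a) + χ₊'(a)|`. The cross term of the
square is `2k` times the flux of `χ₊`, which equals `k` as computed at `b`. -/
theorem norm_jostFunction_sq_plus (hV : Integrable V volume) (hs : essSupport V = Icc a b)
    (k : ℝ) : ‖jostFunction V a b k‖ ^ 2 =
      k ^ 2 * ‖jostPlus V b k a‖ ^ 2 + ‖deriv (jostPlus V b k) a‖ ^ 2 + 2 * k ^ 2 := by
  have hu := solvesOn_jostPlus hV hs (k : ℂ)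
  rw [← Complex.ofReal_pow] at hu
  have h := hu.im_deriv_mul_conj_eq hV b a
  obtain ⟨e0, e1⟩ := jostPlus_of_le hV hs (k : ℂ) (le_refl b)
  have hb : (deriv (jostPlus V b k) b * (starRingEnd ℂ) (jostPlus V b k b)).im = k := by
    rw [e0, e1, mul_assoc, Complex.mul_conj, Complex.normSq_eq_norm_sq, norm_exp_I_mul]
    simp
  rw [hb] at h
  obtain ⟨m0, m1⟩ := jostMinus_of_le hV hs (k : ℂ) (le_refl a)
  have hw : jostFunction V a b k = -((Complex.I * k * jostPlus V b k a + deriv (jostPlus V b k) a) *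
      Complex.exp (-(Complex.I * k * a))) := by
    rw [← jostFunction_eq hV hs k a, m0, m1]; ring
  rw [hw, norm_neg, norm_mul, norm_exp_neg_I_mul, mul_one, Complex.sq_norm, Complex.sq_norm,
    Complex.sq_norm, Complex.normSq_apply, Complex.normSq_apply, Complex.normSq_apply]
  simp only [Complex.add_re, Complex.mul_re, Complex.I_re, Complex.ofReal_re, Complex.I_im,
    Complex.ofReal_im, Complex.mul_im, Complex.add_im, Complex.conj_re, Complex.conj_im] at h ⊢
  linear_combination 2 * k * h

theorem norm_jostFunction_sq_minus (hV : Integrable V volume) (hs : essSupport V = Icc a b)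
    (k : ℝ) : ‖jostFunction V a b k‖ ^ 2 =
      k ^ 2 * ‖jostMinus V a k b‖ ^ 2 + ‖deriv (jostMinus V a k) b‖ ^ 2 + 2 * k ^ 2 := by
  have hu := solvesOn_jostMinus hV hs (k : ℂ)
  rw [← Complex.ofReal_pow] at hu
  have h := hu.im_deriv_mul_conj_eq hV a b
  obtain ⟨e0, e1⟩ := jostMinus_of_le hV hs (k : ℂ) (le_refl a)
  have hb : (deriv (jostMinus V a k) a * (starRingEnd ℂ) (jostMinus V a k a)).im = -k := by
    rw [e0, e1, mul_assoc, Complex.mul_conj, Complex.normSq_eq_norm_sq, norm_exp_neg_I_mul]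
    simp
  rw [hb] at h
  obtain ⟨m0, m1⟩ := jostPlus_of_le hV hs (k : ℂ) (le_refl b)
  have hw : jostFunction V a b k = (deriv (jostMinus V a k) b - Complex.I * k * jostMinus V a k b) *
      Complex.exp (Complex.I * k * b) := by
    rw [← jostFunction_eq hV hs k b, m0, m1]; ring
  rw [hw, norm_mul, norm_exp_I_mul, mul_one, Complex.sq_norm, Complex.sq_norm,
    Complex.sq_norm, Complex.normSq_apply, Complex.normSq_apply, Complex.normSq_apply]
  simp only [Complex.sub_re, Complex.mul_re, Complex.I_re, Complex.ofReal_re, Complex.I_im,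
    Complex.ofReal_im, Complex.mul_im, Complex.sub_im, Complex.conj_re, Complex.conj_im] at h ⊢
  linear_combination (-2 * k) * h

/-- Positivity of the potential excludes a zero-energy resonance. -/
theorem jostFunction_zero_ne_zero (hab : a < b) (hV : Integrable V volume)
    (hs : essSupport V = Icc a b) (hpos : FormPositive V a b) : jostFunction V a b 0 ≠ 0 := by
  intro hw
  set u := jostPlus V b 0 with hu_def
  have hu := solvesOn_jostPlus hV hs (0 : ℂ)
  obtain ⟨e0, e1⟩ := jostPlus_of_le hV hs (0 : ℂ) (le_refl b)
  obtain ⟨m0, m1⟩ := jostMinus_of_le hV hs (0 : ℂ) (le_refl a)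
  have hcont : Continuous u := continuousOn_univ.1 hu.continuousOn
  -- At zero momentum `χ₋` has value `1` and derivative `0` at `a`, so `w(0) = -χ₊'(a)`.
  have hua : deriv u a = 0 := by
    have := jostFunction_eq hV hs 0 a
    rw [hw, m0, m1] at this
    simpa using this
  have hub : deriv u b = 0 := e1.trans (by simp)
  have hub0 : u b = 1 := e0.trans (by simp)
  have hu' : SolvesOn V ((0 : ℝ) : ℂ) univ u := by simpa using hu
  have hparts := mul_sub_mul_eq_integral (x := a) (y := b)
    (f := fun x => (starRingEnd ℂ) (u x)) (g := deriv u)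
    (hu'.conj.continuousOn_deriv_uIcc hV (subset_univ _)).intervalIntegrable
    (hu'.intervalIntegrable hV (subset_univ _))
    (fun t _ => hu'.conj.sub_eq_integral_deriv hV (subset_univ _))
    (fun t _ => hu'.deriv_sub a t (subset_univ _))
  -- Pairing the equation with `ū` leaves no boundary terms, as `u'` vanishes at both ends.
  have hint : ∫ t in a..b, ((‖deriv u t‖ ^ 2 + V t * ‖u t‖ ^ 2 : ℝ) : ℂ) = 0 := by
    rw [hua, hub, mul_zero, mul_zero, sub_zero] at hparts
    rw [hparts]
    refine intervalIntegral.integral_congr fun t _ => ?_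
    simp only [hu'.deriv_conj (mem_univ t), Complex.conj_mul', Complex.ofReal_zero, sub_zero]
    rw [mul_left_comm, Complex.conj_mul']
    push_cast
    ring
  rw [intervalIntegral.integral_ofReal, Complex.ofReal_eq_zero] at hint
  have hVint : IntegrableOn (fun x => V x * ‖u x‖ ^ 2) (Ioc a b) volume :=
    (intervalIntegrable_iff_integrableOn_Ioc_of_le hab.le).1
      (hV.intervalIntegrable.mul_continuousOn (by fun_prop))
  have hdc : Continuous (deriv u) := continuousOn_univ.1 (hu.continuousOn_deriv hV isOpen_univ)
  rw [intervalIntegral.integral_add (Continuous.intervalIntegrable (by fun_prop) _ _)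
    ((intervalIntegrable_iff_integrableOn_Ioc_of_le hab.le).2 hVint)] at hint
  have hnn : 0 ≤ ∫ t in a..b, ‖deriv u t‖ ^ 2 :=
    intervalIntegral.integral_nonneg hab.le fun t _ => by positivity
  have hp := hpos u ?_ ?_ (hVint.mono_set Ioo_subset_Ioc_self)
  · rw [intervalIntegral.integral_of_le (μ := volume) (f := fun x => V x * ‖u x‖ ^ 2) hab.le,
      integral_Ioc_eq_integral_Ioo] at hint
    linarith
  · obtain ⟨C, hC⟩ := isCompact_Icc.exists_bound_of_continuousOn (s := Icc a b) hcont.continuousOn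
    refine MemLp.of_bound hcont.aestronglyMeasurable C ?_
    filter_upwards [ae_restrict_mem measurableSet_Ioo] with t ht
    exact hC t (Ioo_subset_Icc_self ht)
  · intro h0
    have h1 : EqOn u 0 (Ioo a b) := by
      refine Measure.eqOn_open_of_ae_eq h0 isOpen_Ioo hcont.continuousOn continuousOn_const
    have h2 := h1.closure hcont continuous_const (x := b)
      (by rw [closure_Ioo hab.ne]; exact right_mem_Icc.2 hab.le)
    simp [hub0] at h2

theorem jostFunction_ne_zero (hab : a < b) (hV : Integrable V volume)
    (hs : essSupport V = Icc a b) (hpos : FormPositive V a b) (k : ℝ) :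
    jostFunction V a b k ≠ 0 := by
  rcases eq_or_ne k 0 with rfl | hk
  · simpa using jostFunction_zero_ne_zero hab hV hs hpos
  · intro h
    have := norm_jostFunction_sq_plus hV hs k
    rw [h, norm_zero] at this
    have : 0 < k ^ 2 := by positivity
    nlinarith [mul_nonneg this.le (sq_nonneg ‖jostPlus V b k a‖),
      sq_nonneg ‖deriv (jostPlus V b k) a‖]

end JostReal

/-! ### Traces of piecewise combinations of two functions -/

theorem leftLim_eq_of_eqOn {f g : ℝ → ℂ} {p c : ℝ} (hpc : p < c) (h : EqOn f g (Ioo p c))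
    (hg : Continuous g) : Function.leftLim f c = g c := by
  refine leftLim_eq_of_tendsto ((hg.tendsto c).mono_left nhdsWithin_le_nhds |>.congr' ?_)
  exact (h.symm).eventuallyEq_of_mem (Ioo_mem_nhdsLT hpc)

theorem rightLim_eq_of_eqOn {f g : ℝ → ℂ} {p c : ℝ} (hpc : c < p) (h : EqOn f g (Ioo c p))
    (hg : Continuous g) : Function.rightLim f c = g c := by
  refine rightLim_eq_of_tendsto ((hg.tendsto c).mono_left nhdsWithin_le_nhds |>.congr' ?_)
  exact (h.symm).eventuallyEq_of_mem (Ioo_mem_nhdsGT hpc)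

theorem eqOn_deriv_Ioo {f g : ℝ → ℂ} {p q : ℝ} (h : EqOn f g (Ioo p q)) :
    EqOn (deriv f) (deriv g) (Ioo p q) := fun _ hx =>
  (h.eventuallyEq_of_mem (isOpen_Ioo.mem_nhds hx)).deriv_eq

/-- The combination `z.1 * P + z.2 * N`. -/
def comb (P N : ℝ → ℂ) (z : ℂ × ℂ) (x : ℝ) : ℂ := z.1 * P x + z.2 * N x

/-- `f` is a combination of `P` and `N` on each of the intervals cut out by `a` and `b`. -/
structure IsPiecewise (P N : ℝ → ℂ) (a b : ℝ) (l m r : ℂ × ℂ) (f : ℝ → ℂ) : Prop where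
  left : ∀ x, x < a → f x = comb P N l x
  mid : ∀ x, a < x → x < b → f x = comb P N m x
  right : ∀ x, b < x → f x = comb P N r x

namespace IsPiecewise

variable {P N f g : ℝ → ℂ} {a b : ℝ} {l m r : ℂ × ℂ}

theorem congr (hf : IsPiecewise P N a b l m r f) (hab : a < b)
    (h : ∀ x ∈ ({a, b}ᶜ : Set ℝ), g x = f x) :
    IsPiecewise P N a b l m r g := by
  have key : ∀ x, x ≠ a → x ≠ b → g x = f x := fun x h1 h2 => h x (by simp [h1, h2])
  refine ⟨fun x hx => ?_, fun x h1 h2 => ?_, fun x hx => ?_⟩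
  · rw [key x hx.ne (hx.trans hab).ne, hf.left x hx]
  · rw [key x h1.ne' h2.ne, hf.mid x h1 h2]
  · rw [key x (hab.trans hx).ne' hx.ne', hf.right x hx]

theorem eq_of_mem (hf : IsPiecewise P N a b l m r f) (hg : IsPiecewise P N a b l m r g)
    {x : ℝ} (hx : x ∈ ({a, b}ᶜ : Set ℝ)) : f x = g x := by
  simp only [mem_compl_iff, mem_insert_iff, mem_singleton_iff, not_or] at hx
  rcases lt_or_gt_of_ne hx.1 with h | h
  · rw [hf.left x h, hg.left x h]
  · rcases lt_or_gt_of_ne hx.2 with h' | h'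
    · rw [hf.mid x h h', hg.mid x h h']
    · rw [hf.right x h', hg.right x h']

end IsPiecewise

theorem deriv_comb {P N : ℝ → ℂ} (hP : Differentiable ℝ P) (hN : Differentiable ℝ N)
    (z : ℂ × ℂ) : deriv (comb P N z) = comb (deriv P) (deriv N) z := by
  funext x
  exact (((hP x).hasDerivAt.const_mul z.1).add ((hN x).hasDerivAt.const_mul z.2)).deriv

/-- The one-sided limits at `a` and `b` of a function and of its derivative. -/
structure HasTraces (a b : ℝ) (f : ℝ → ℂ) (la ra lb rb dla dra dlb drb : ℂ) : Prop where
  left_a : Function.leftLim f a = la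
  right_a : Function.rightLim f a = ra
  left_b : Function.leftLim f b = lb
  right_b : Function.rightLim f b = rb
  deriv_left_a : Function.leftLim (deriv f) a = dla
  deriv_right_a : Function.rightLim (deriv f) a = dra
  deriv_left_b : Function.leftLim (deriv f) b = dlb
  deriv_right_b : Function.rightLim (deriv f) b = drb

theorem IsPiecewise.hasTraces {P N f : ℝ → ℂ} {a b : ℝ} {l m r : ℂ × ℂ} (hab : a < b)
    (hP : ContDiff ℝ 1 P) (hN : ContDiff ℝ 1 N) (hf : IsPiecewise P N a b l m r f) :
    HasTraces a b f (comb P N l a) (comb P N m a) (comb P N m b) (comb P N r b)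
      (comb (deriv P) (deriv N) l a) (comb (deriv P) (deriv N) m a)
      (comb (deriv P) (deriv N) m b) (comb (deriv P) (deriv N) r b) := by
  have hd : ∀ z, deriv (comb P N z) = comb (deriv P) (deriv N) z :=
    deriv_comb (hP.differentiable one_ne_zero) (hN.differentiable one_ne_zero)
  have hc : ∀ {P N : ℝ → ℂ} (z : ℂ × ℂ), Continuous P → Continuous N → Continuous (comb P N z) :=
    fun z h1 h2 => (continuous_const.mul h1).add (continuous_const.mul h2)
  have c0 := fun z => hc z hP.continuous hN.continuous
  have c1 := fun z => hc z (hP.continuous_deriv le_rfl) (hN.continuous_deriv le_rfl)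
  have eL : EqOn f (comb P N l) (Ioo (a - 1) a) := fun x hx => hf.left x hx.2
  have eM : EqOn f (comb P N m) (Ioo a b) := fun x hx => hf.mid x hx.1 hx.2
  have eR : EqOn f (comb P N r) (Ioo b (b + 1)) := fun x hx => hf.right x hx.1
  have dL := eqOn_deriv_Ioo eL
  have dM := eqOn_deriv_Ioo eM
  have dR := eqOn_deriv_Ioo eR
  rw [hd] at dL dM dR
  exact ⟨leftLim_eq_of_eqOn (sub_one_lt a) eL (c0 l), rightLim_eq_of_eqOn hab eM (c0 m),
    leftLim_eq_of_eqOn hab eM (c0 m), rightLim_eq_of_eqOn (lt_add_one b) eR (c0 r),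
    leftLim_eq_of_eqOn (sub_one_lt a) dL (c1 l), rightLim_eq_of_eqOn hab dM (c1 m),
    leftLim_eq_of_eqOn hab dM (c1 m), rightLim_eq_of_eqOn (lt_add_one b) dR (c1 r)⟩

theorem IsPiecewise.boundaryOne_eq {P N f : ℝ → ℂ} {a b : ℝ} {l m r : ℂ × ℂ} (hab : a < b)
    (hP : ContDiff ℝ 1 P) (hN : ContDiff ℝ 1 N) (hf : IsPiecewise P N a b l m r f) :
    boundaryOne a b f = ![(comb P N r b + comb P N m b) / 2,
      (comb (deriv P) (deriv N) r b + comb (deriv P) (deriv N) m b) / 2,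
      (comb P N m a + comb P N l a) / 2,
      (comb (deriv P) (deriv N) m a + comb (deriv P) (deriv N) l a) / 2] := by
  have h := hf.hasTraces hab hP hN
  rw [boundaryOne, h.left_a, h.right_a, h.left_b, h.right_b, h.deriv_left_a, h.deriv_right_a,
    h.deriv_left_b, h.deriv_right_b]

/-! ### Piecewise combinations of Jost solutions -/

section

variable {V : ℝ → ℝ} {a b : ℝ}

theorem contDiff_jostPlus (hV : Integrable V volume) (hs : essSupport V = Icc a b) (ζ : ℂ) :
    ContDiff ℝ 1 (jostPlus V b ζ) :=
  contDiffOn_univ.1 ((solvesOn_jostPlus hV hs ζ).contDiffOn hV isOpen_univ)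

theorem contDiff_jostMinus (hV : Integrable V volume) (hs : essSupport V = Icc a b) (ζ : ℂ) :
    ContDiff ℝ 1 (jostMinus V a ζ) :=
  contDiffOn_univ.1 ((solvesOn_jostMinus hV hs ζ).contDiffOn hV isOpen_univ)

theorem solvesOn_comb (hV : Integrable V volume) (hs : essSupport V = Icc a b) (ζ : ℂ)
    (z : ℂ × ℂ) : SolvesOn V (ζ ^ 2) univ (comb (jostPlus V b ζ) (jostMinus V a ζ) z) :=
  ((solvesOn_jostPlus hV hs ζ).const_mul z.1).add hV ((solvesOn_jostMinus hV hs ζ).const_mul z.2)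

theorem IsPiecewise.solvesOn (hV : Integrable V volume) (hs : essSupport V = Icc a b) {ζ : ℂ}
    {l m r : ℂ × ℂ} {f : ℝ → ℂ}
    (hf : IsPiecewise (jostPlus V b ζ) (jostMinus V a ζ) a b l m r f) :
    SolvesOn V (ζ ^ 2) ({a, b}ᶜ : Set ℝ) f := by
  have hL : SolvesOn V (ζ ^ 2) (Iio a) f :=
    ((solvesOn_comb hV hs ζ l).mono (subset_univ _)).congr isOpen_Iio fun x hx => hf.left x hx
  have hM : SolvesOn V (ζ ^ 2) (Ioo a b) f :=
    ((solvesOn_comb hV hs ζ m).mono (subset_univ _)).congr isOpen_Ioo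
      fun x hx => hf.mid x hx.1 hx.2
  have hR : SolvesOn V (ζ ^ 2) (Ioi b) f :=
    ((solvesOn_comb hV hs ζ r).mono (subset_univ _)).congr isOpen_Ioi fun x hx => hf.right x hx
  -- An interval that avoids `a` and `b` lies in a single component.
  have hcov : ∀ x y : ℝ, uIcc x y ⊆ ({a, b}ᶜ : Set ℝ) →
      uIcc x y ⊆ Iio a ∨ uIcc x y ⊆ Ioo a b ∨ uIcc x y ⊆ Ioi b := by
    intro x y h
    have ha : a ∉ uIcc x y := fun h' => h h' (by simp)
    have hb : b ∉ uIcc x y := fun h' => h h' (by simp)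
    rw [uIcc, mem_Icc, not_and_or, not_le, not_le] at ha hb
    rcases ha with ha | ha
    · rcases hb with hb | hb
      · exact Or.inr (Or.inr fun t ht => hb.trans_le ht.1)
      · exact Or.inr (Or.inl fun t ht => ⟨ha.trans_le ht.1, ht.2.trans_lt hb⟩)
    · exact Or.inl fun t ht => ht.2.trans_lt ha
  refine ⟨fun x hx => ?_, fun x y h => ?_⟩
  · have hx' : x ∈ uIcc x x := by simp
    rcases hcov x x (by simpa using hx) with h | h | h
    · exact hL.differentiableAt x (h hx')
    · exact hM.differentiableAt x (h hx')
    · exact hR.differentiableAt x (h hx')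
  · rcases hcov x y h with h | h | h
    · exact hL.deriv_sub x y h
    · exact hM.deriv_sub x y h
    · exact hR.deriv_sub x y h

theorem SolvesOn.exists_comb (hV : Integrable V volume) (hs : essSupport V = Icc a b)
    {ζ : ℂ} (hw : jostFunction V a b ζ ≠ 0) {s : Set ℝ} [s.OrdConnected] {u : ℝ → ℂ}
    (hu : SolvesOn V (ζ ^ 2) s u) {c : ℝ} (hc : c ∈ s) {x : ℝ} (hx : x ∈ s) :
    u x = comb (jostPlus V b ζ) (jostMinus V a ζ)
      (wronskian u (jostMinus V a ζ) c / jostFunction V a b ζ,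
        -wronskian u (jostPlus V b ζ) c / jostFunction V a b ζ) x := by
  have h := hu.mul_jostFunction_eq hV hs (OrdConnected.uIcc_subset ‹_› hc hx)
  rw [comb]
  field_simp
  linear_combination h

/-- To the left of its source a defect function is a multiple of `χ₋`, to the right a multiple of
`χ₊`. The sources are `b, b, a, a`, which decides the middle interval. -/
theorem isPiecewise_defectFun (hab : a < b) (ζ : ℂ) (i : Fin 4) :
    IsPiecewise (jostPlus V b ζ) (jostMinus V a ζ) a b
      (![(0, jostPlus V b ζ b / jostFunction V a b ζ),
        (0, deriv (jostPlus V b ζ) b / jostFunction V a b ζ),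
        (0, jostPlus V b ζ a / jostFunction V a b ζ),
        (0, deriv (jostPlus V b ζ) a / jostFunction V a b ζ)] i)
      (![(0, jostPlus V b ζ b / jostFunction V a b ζ),
        (0, deriv (jostPlus V b ζ) b / jostFunction V a b ζ),
        (jostMinus V a ζ a / jostFunction V a b ζ, 0),
        (deriv (jostMinus V a ζ) a / jostFunction V a b ζ, 0)] i)
      (![(jostMinus V a ζ b / jostFunction V a b ζ, 0),
        (deriv (jostMinus V a ζ) b / jostFunction V a b ζ, 0),
        (jostMinus V a ζ a / jostFunction V a b ζ, 0),
        (deriv (jostMinus V a ζ) a / jostFunction V a b ζ, 0)] i)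
      (defectFun V a b i ζ) := by
  have e1 : ∀ x : ℝ, x < a → ¬ b ≤ x := fun x hx => not_le.2 (hx.trans hab)
  have e2 : ∀ x : ℝ, x < a → ¬ a ≤ x := fun x hx => not_le.2 hx
  fin_cases i <;> refine ⟨fun x hx => ?_, fun x h1 h2 => ?_, fun x hx => ?_⟩ <;>
    simp only [defectFun, greenG, greenH, comb, Fin.zero_eta, Fin.mk_one, Fin.reduceFinMk,
      Matrix.cons_val]
  · rw [if_neg (e1 x hx)]; ring
  · rw [if_neg (not_le.2 h2)]; ring
  · rw [if_pos hx.le]; ring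
  · rw [if_neg (e1 x hx)]; ring
  · rw [if_neg (not_le.2 h2)]; ring
  · rw [if_pos hx.le]; ring
  · rw [if_neg (e2 x hx)]; ring
  · rw [if_pos h1.le]; ring
  · rw [if_pos (hab.trans hx).le]; ring
  · rw [if_neg (e2 x hx)]; ring
  · rw [if_pos h1.le]; ring
  · rw [if_pos (hab.trans hx).le]; ring

/-- The function `z.1 * χ₊ + z.2 * χ₋ + ∑ i, c i * g(e_i)`. -/
noncomputable def combDefect (V : ℝ → ℝ) (a b : ℝ) (ζ : ℂ) (z : ℂ × ℂ) (c : Fin 4 → ℂ)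
    (x : ℝ) : ℂ :=
  comb (jostPlus V b ζ) (jostMinus V a ζ) z x + ∑ i, c i * defectFun V a b i ζ x

theorem isPiecewise_combDefect (hab : a < b) (ζ : ℂ) (z : ℂ × ℂ) (c : Fin 4 → ℂ) :
    IsPiecewise (jostPlus V b ζ) (jostMinus V a ζ) a b
      (z.1, z.2 + (c 0 * jostPlus V b ζ b + c 1 * deriv (jostPlus V b ζ) b +
        c 2 * jostPlus V b ζ a + c 3 * deriv (jostPlus V b ζ) a) / jostFunction V a b ζ)
      (z.1 + (c 2 * jostMinus V a ζ a + c 3 * deriv (jostMinus V a ζ) a) / jostFunction V a b ζ,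
        z.2 + (c 0 * jostPlus V b ζ b + c 1 * deriv (jostPlus V b ζ) b) / jostFunction V a b ζ)
      (z.1 + (c 0 * jostMinus V a ζ b + c 1 * deriv (jostMinus V a ζ) b +
        c 2 * jostMinus V a ζ a + c 3 * deriv (jostMinus V a ζ) a) / jostFunction V a b ζ, z.2)
      (combDefect V a b ζ z c) := by
  have h := fun i => isPiecewise_defectFun (V := V) hab ζ i
  refine ⟨fun x hx => ?_, fun x h1 h2 => ?_, fun x hx => ?_⟩
  · simp only [combDefect, Fin.sum_univ_four, (h _).left x hx, comb, Matrix.cons_val]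
    ring
  · simp only [combDefect, Fin.sum_univ_four, (h _).mid x h1 h2, comb, Matrix.cons_val]
    ring
  · simp only [combDefect, Fin.sum_univ_four, (h _).right x hx, comb, Matrix.cons_val]
    ring

theorem isPiecewise_comb (ζ : ℂ) (z : ℂ × ℂ) :
    IsPiecewise (jostPlus V b ζ) (jostMinus V a ζ) a b z z z
      (comb (jostPlus V b ζ) (jostMinus V a ζ) z) :=
  ⟨fun _ _ => rfl, fun _ _ _ => rfl, fun _ _ => rfl⟩

theorem boundaryOne_comb (hab : a < b) (hV : Integrable V volume) (hs : essSupport V = Icc a b)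
    (ζ : ℂ) (z : ℂ × ℂ) : boundaryOne a b (comb (jostPlus V b ζ) (jostMinus V a ζ) z) =
      ![comb (jostPlus V b ζ) (jostMinus V a ζ) z b,
        comb (deriv (jostPlus V b ζ)) (deriv (jostMinus V a ζ)) z b,
        comb (jostPlus V b ζ) (jostMinus V a ζ) z a,
        comb (deriv (jostPlus V b ζ)) (deriv (jostMinus V a ζ)) z a] := by
  rw [(isPiecewise_comb ζ z).boundaryOne_eq hab (contDiff_jostPlus hV hs ζ)
    (contDiff_jostMinus hV hs ζ)]
  simp only [add_self_div_two]

/-- The Weyl matrix in terms of the boundary values of the Jost solutions. -/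
theorem weylMatrix_eq (hab : a < b) (hV : Integrable V volume) (hs : essSupport V = Icc a b)
    (ζ : ℂ) : weylMatrix V a b ζ =
    (jostFunction V a b ζ)⁻¹ • !![
      jostMinus V a ζ b * jostPlus V b ζ b,
      (deriv (jostMinus V a ζ) b * jostPlus V b ζ b +
        jostMinus V a ζ b * deriv (jostPlus V b ζ) b) / 2,
      jostMinus V a ζ a * jostPlus V b ζ b, deriv (jostMinus V a ζ) a * jostPlus V b ζ b;
      (deriv (jostMinus V a ζ) b * jostPlus V b ζ b +
        jostMinus V a ζ b * deriv (jostPlus V b ζ) b) / 2,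
      deriv (jostMinus V a ζ) b * deriv (jostPlus V b ζ) b,
      jostMinus V a ζ a * deriv (jostPlus V b ζ) b,
      deriv (jostMinus V a ζ) a * deriv (jostPlus V b ζ) b;
      jostMinus V a ζ a * jostPlus V b ζ b, jostMinus V a ζ a * deriv (jostPlus V b ζ) b,
      jostMinus V a ζ a * jostPlus V b ζ a,
      (deriv (jostMinus V a ζ) a * jostPlus V b ζ a +
        jostMinus V a ζ a * deriv (jostPlus V b ζ) a) / 2;
      deriv (jostMinus V a ζ) a * jostPlus V b ζ b,
      deriv (jostMinus V a ζ) a * deriv (jostPlus V b ζ) b,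
      (deriv (jostMinus V a ζ) a * jostPlus V b ζ a +
        jostMinus V a ζ a * deriv (jostPlus V b ζ) a) / 2,
      deriv (jostMinus V a ζ) a * deriv (jostPlus V b ζ) a] := by
  have h := fun j => (isPiecewise_defectFun (V := V) hab ζ j).boundaryOne_eq hab
    (contDiff_jostPlus hV hs ζ) (contDiff_jostMinus hV hs ζ)
  ext i j
  rw [weylMatrix, Matrix.of_apply, h j]
  fin_cases j <;> fin_cases i <;>
    simp only [comb, Fin.zero_eta, Fin.mk_one, Fin.reduceFinMk, Matrix.cons_val, Matrix.smul_apply,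
      Matrix.of_apply, smul_eq_mul] <;> ring

/-- `Γ` holds the averages and `c` the jumps: `c 1` and `c 3` are the jumps of `u` at `b` and `a`,
while `-c 0` and `-c 2` are those of `u'`. The jumps are normalized because `χ₊ χ₋' - χ₊' χ₋ = w`.
-/
theorem hasTraces_combDefect (hab : a < b) (hV : Integrable V volume)
    (hs : essSupport V = Icc a b) {ζ : ℂ} (hw : jostFunction V a b ζ ≠ 0) (z : ℂ × ℂ)
    (c Γ : Fin 4 → ℂ) (hΓ : Γ = boundaryOne a b (comb (jostPlus V b ζ) (jostMinus V a ζ) z) +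
      (weylMatrix V a b ζ).mulVec c) {u : ℝ → ℂ}
    (hu : ∀ x ∈ ({a, b}ᶜ : Set ℝ), u x = combDefect V a b ζ z c x) :
    HasTraces a b u (Γ 2 - c 3 / 2) (Γ 2 + c 3 / 2) (Γ 0 - c 1 / 2) (Γ 0 + c 1 / 2)
      (Γ 3 + c 2 / 2) (Γ 3 - c 2 / 2) (Γ 1 + c 0 / 2) (Γ 1 - c 0 / 2) := by
  have h := ((isPiecewise_combDefect hab ζ z c).congr hab hu).hasTraces hab
    (contDiff_jostPlus hV hs ζ) (contDiff_jostMinus hV hs ζ)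
  have ha := jostFunction_eq hV hs ζ a
  have hb := jostFunction_eq hV hs ζ b
  rw [boundaryOne_comb hab hV hs, weylMatrix_eq hab hV hs] at hΓ
  have g0 := congrFun hΓ 0
  have g1 := congrFun hΓ 1
  have g2 := congrFun hΓ 2
  have g3 := congrFun hΓ 3
  simp only [Pi.add_apply, Matrix.mulVec, dotProduct, Fin.sum_univ_four, Matrix.smul_apply,
    Matrix.of_apply, Matrix.cons_val, smul_eq_mul, comb] at g0 g1 g2 g3
  obtain ⟨h1, h2, h3, h4, h5, h6, h7, h8⟩ := h
  constructor
  · rw [h1, g2]; simp only [comb]; field_simp; linear_combination (-c 3) * ha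
  · rw [h2, g2]; simp only [comb]; field_simp; linear_combination (c 3) * ha
  · rw [h3, g0]; simp only [comb]; field_simp; linear_combination (-c 1) * hb
  · rw [h4, g0]; simp only [comb]; field_simp; linear_combination (c 1) * hb
  · rw [h5, g3]; simp only [comb]; field_simp; linear_combination (c 2) * ha
  · rw [h6, g3]; simp only [comb]; field_simp; linear_combination (-c 2) * ha
  · rw [h7, g1]; simp only [comb]; field_simp; linear_combination (c 0) * hb
  · rw [h8, g1]; simp only [comb]; field_simp; linear_combination (-c 0) * hb

end

/-! ### The interface problem -/

section Interface

variable {V : ℝ → ℝ} {a b : ℝ} {ζ : ℂ} {z θ : ℂ × ℂ} {u : ℝ → ℂ}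

/-- The interface conditions of `Q_{θ₁,θ₂}(V)` at `a` and `b`. -/
structure SatisfiesInterface (a b : ℝ) (θ : ℂ × ℂ) (u : ℝ → ℂ) : Prop where
  value_b : Complex.exp (-θ.1 / 2) * Function.rightLim u b = Function.leftLim u b
  deriv_b : Complex.exp (-θ.2 / 2) * Function.rightLim (deriv u) b = Function.leftLim (deriv u) b
  value_a : Complex.exp (-θ.1 / 2) * Function.leftLim u a = Function.rightLim u a
  deriv_a : Complex.exp (-θ.2 / 2) * Function.leftLim (deriv u) a = Function.rightLim (deriv u) a

theorem matA_mulVec (θ : ℂ × ℂ) (c : Fin 4 → ℂ) : (matA θ).mulVec c =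
    ![(1 + Complex.exp (θ.2 / 2)) * c 0, (1 + Complex.exp (θ.1 / 2)) * c 1,
      (1 + Complex.exp (-θ.2 / 2)) * c 2, (1 + Complex.exp (-θ.1 / 2)) * c 3] := by
  funext i
  rw [matA, Matrix.mulVec_diagonal]
  fin_cases i <;> rfl

theorem matB_mulVec (θ : ℂ × ℂ) (c : Fin 4 → ℂ) : (matB θ).mulVec c =
    ![2 * (1 - Complex.exp (θ.2 / 2)) * c 1, 2 * (Complex.exp (θ.1 / 2) - 1) * c 0,
      2 * (1 - Complex.exp (-θ.2 / 2)) * c 3, 2 * (Complex.exp (-θ.1 / 2) - 1) * c 2] := by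
  funext i
  fin_cases i <;> simp [matB, Matrix.mulVec, dotProduct, Fin.sum_univ_four]

/-- Each interface condition, written with half-sums and jumps, is one row of the system. Those at
`b` are first multiplied by `exp (θ / 2)`, those at `a` are not; hence the opposite signs of `θ` in
the two blocks. -/
theorem satisfiesInterface_iff {c Γ : Fin 4 → ℂ}
    (h : HasTraces a b u (Γ 2 - c 3 / 2) (Γ 2 + c 3 / 2) (Γ 0 - c 1 / 2) (Γ 0 + c 1 / 2)
      (Γ 3 + c 2 / 2) (Γ 3 - c 2 / 2) (Γ 1 + c 0 / 2) (Γ 1 - c 0 / 2)) :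
    SatisfiesInterface a b θ u ↔ (matB θ).mulVec Γ = (matA θ).mulVec c := by
  rw [matA_mulVec, matB_mulVec]
  have e1 : Complex.exp (θ.1 / 2) * Complex.exp (-θ.1 / 2) = 1 := by
    rw [← Complex.exp_add]; simp [neg_div]
  have e2 : Complex.exp (θ.2 / 2) * Complex.exp (-θ.2 / 2) = 1 := by
    rw [← Complex.exp_add]; simp [neg_div]
  constructor
  · rintro ⟨h1, h2, h3, h4⟩
    rw [h.right_b, h.left_b] at h1
    rw [h.deriv_right_b, h.deriv_left_b] at h2
    rw [h.right_a, h.left_a] at h3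
    rw [h.deriv_right_a, h.deriv_left_a] at h4
    funext i
    fin_cases i <;>
      simp only [Fin.zero_eta, Fin.mk_one, Fin.reduceFinMk, Matrix.cons_val]
    · linear_combination 2 * Complex.exp (θ.2 / 2) * h2 - 2 * (Γ 1 - c 0 / 2) * e2
    · linear_combination -2 * Complex.exp (θ.1 / 2) * h1 + 2 * (Γ 0 + c 1 / 2) * e1
    · linear_combination -2 * h4
    · linear_combination 2 * h3
  · intro hc
    have r0 := congrFun hc 0
    have r1 := congrFun hc 1
    have r2 := congrFun hc 2
    have r3 := congrFun hc 3
    simp only [Matrix.cons_val] at r0 r1 r2 r3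
    refine ⟨?_, ?_, ?_, ?_⟩
    · rw [h.right_b, h.left_b]
      linear_combination -(Complex.exp (-θ.1 / 2) / 2) * r1 + (Γ 0 - c 1 / 2) * e1
    · rw [h.deriv_right_b, h.deriv_left_b]
      linear_combination (Complex.exp (-θ.2 / 2) / 2) * r0 + (Γ 1 + c 0 / 2) * e2
    · rw [h.right_a, h.left_a]
      linear_combination (1 / 2) * r3
    · rw [h.deriv_right_a, h.deriv_left_a]
      linear_combination (-1 / 2) * r2

/-- The coefficients of the defect functions in the solution of the interface problem. -/
noncomputable def defectCoeff (V : ℝ → ℝ) (a b : ℝ) (ζ : ℂ) (z θ : ℂ × ℂ) : Fin 4 → ℂ :=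
  -(((matM V a b ζ θ)⁻¹ * matB θ).mulVec
    (boundaryOne a b (comb (jostPlus V b ζ) (jostMinus V a ζ) z)))

/-- Inserting `Γ = Γ₁ φ + q c` into `B Γ = A c` gives `M c = -B Γ₁ φ`. -/
theorem satisfiesInterface_combDefect_iff (hab : a < b) (hV : Integrable V volume)
    (hs : essSupport V = Icc a b) (hw : jostFunction V a b ζ ≠ 0)
    (hM : IsUnit (matM V a b ζ θ)) {c : Fin 4 → ℂ}
    (hu : ∀ x ∈ ({a, b}ᶜ : Set ℝ), u x = combDefect V a b ζ z c x) :
    SatisfiesInterface a b θ u ↔ c = defectCoeff V a b ζ z θ := by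
  rw [satisfiesInterface_iff (hasTraces_combDefect hab hV hs hw z c _ rfl hu)]
  have hdet := (Matrix.isUnit_iff_isUnit_det _).1 hM
  set φ := boundaryOne a b (comb (jostPlus V b ζ) (jostMinus V a ζ) z) with hφ
  have hMc : (matM V a b ζ θ).mulVec c =
      (matB θ).mulVec ((weylMatrix V a b ζ).mulVec c) - (matA θ).mulVec c := by
    rw [matM, Matrix.sub_mulVec, Matrix.mulVec_mulVec]
  have step : (matB θ).mulVec (φ + (weylMatrix V a b ζ).mulVec c) = (matA θ).mulVec c ↔
      (matM V a b ζ θ).mulVec c = -(matB θ).mulVec φ := by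
    rw [Matrix.mulVec_add, hMc, sub_eq_iff_eq_add, neg_add_eq_sub, eq_sub_iff_add_eq, add_comm]
  rw [step, defectCoeff, ← hφ, ← Matrix.mulVec_mulVec]
  generalize (matB θ).mulVec φ = y
  rw [← Matrix.mulVec_neg]
  constructor
  · intro h
    rw [← h, Matrix.mulVec_mulVec, Matrix.nonsing_inv_mul _ hdet, Matrix.one_mulVec]
  · intro h
    rw [h, Matrix.mulVec_mulVec, Matrix.mul_nonsing_inv _ hdet, Matrix.one_mulVec]

/-- The interface problem with the incoming wave prescribed by the coefficient `z.1` of `χ₊` on the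
left and the coefficient `z.2` of `χ₋` on the right. -/
structure IsJostIncoming (V : ℝ → ℝ) (a b : ℝ) (ζ : ℂ) (z θ : ℂ × ℂ) (u : ℝ → ℂ) : Prop where
  solves : SolvesOn V (ζ ^ 2) ({a, b}ᶜ : Set ℝ) u
  interface : SatisfiesInterface a b θ u
  left : ∃ β, ∀ x, x < a → u x = comb (jostPlus V b ζ) (jostMinus V a ζ) (z.1, β) x
  right : ∃ α, ∀ x, b < x → u x = comb (jostPlus V b ζ) (jostMinus V a ζ) (α, z.2) x

theorem isJostIncoming_combDefect (hab : a < b) (hV : Integrable V volume)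
    (hs : essSupport V = Icc a b) (hw : jostFunction V a b ζ ≠ 0)
    (hM : IsUnit (matM V a b ζ θ)) :
    IsJostIncoming V a b ζ z θ (combDefect V a b ζ z (defectCoeff V a b ζ z θ)) := by
  have h := isPiecewise_combDefect (V := V) hab ζ z (defectCoeff V a b ζ z θ)
  exact ⟨h.solvesOn hV hs, (satisfiesInterface_combDefect_iff hab hV hs hw hM fun _ _ => rfl).2 rfl,
    ⟨_, h.left⟩, ⟨_, h.right⟩⟩

/-- The four coefficients left free by the incoming data are matched by the four defect
coefficients, so every solution has the form to which the interface criterion applies. -/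
theorem IsJostIncoming.eq_combDefect (hab : a < b) (hV : Integrable V volume)
    (hs : essSupport V = Icc a b) (hw : jostFunction V a b ζ ≠ 0)
    (hM : IsUnit (matM V a b ζ θ)) (hu : IsJostIncoming V a b ζ z θ u) :
    ∀ x ∈ ({a, b}ᶜ : Set ℝ), u x = combDefect V a b ζ z (defectCoeff V a b ζ z θ) x := by
  obtain ⟨β, hβ⟩ := hu.left
  obtain ⟨α, hα⟩ := hu.right
  have hmid : SolvesOn V (ζ ^ 2) (Ioo a b) u := hu.solves.mono fun x hx => by
    simp [hx.1.ne', hx.2.ne]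
  obtain ⟨p, q, hpq⟩ : ∃ p q, ∀ x, a < x → x < b →
      u x = comb (jostPlus V b ζ) (jostMinus V a ζ) (p, q) x :=
    ⟨_, _, fun x h1 h2 => hmid.exists_comb hV hs hw (c := (a + b) / 2)
      ⟨by linarith, by linarith⟩ ⟨h1, h2⟩⟩
  have ha := jostFunction_eq hV hs ζ a
  have hb := jostFunction_eq hV hs ζ b
  -- These are the jumps `-[u'](b)`, `[u](b)`, `-[u'](a)`, `[u](a)`, written with the coefficients
  -- of `u` on the three components.
  set c : Fin 4 → ℂ := ![
    -(α - p) * deriv (jostPlus V b ζ) b + (q - z.2) * deriv (jostMinus V a ζ) b,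
    (α - p) * jostPlus V b ζ b - (q - z.2) * jostMinus V a ζ b,
    (β - q) * deriv (jostMinus V a ζ) a - (p - z.1) * deriv (jostPlus V b ζ) a,
    (p - z.1) * jostPlus V b ζ a - (β - q) * jostMinus V a ζ a] with hc
  have hpw : IsPiecewise (jostPlus V b ζ) (jostMinus V a ζ) a b (z.1, β) (p, q) (α, z.2)
      (combDefect V a b ζ z c) := by
    have h := isPiecewise_combDefect (V := V) hab ζ z c
    simp only [hc, Matrix.cons_val] at h ⊢
    convert h using 2
    · field_simp
      linear_combination (-(q - z.2)) * hb - (β - q) * ha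
    · field_simp
      linear_combination (-(p - z.1)) * ha
    · field_simp
      linear_combination (-(q - z.2)) * hb
    · field_simp
      linear_combination (-(α - p)) * hb - (p - z.1) * ha
  have huc : ∀ x ∈ ({a, b}ᶜ : Set ℝ), u x = combDefect V a b ζ z c x := fun x hx =>
    IsPiecewise.eq_of_mem ⟨hβ, hpq, hα⟩ hpw hx
  rw [← (satisfiesInterface_combDefect_iff hab hV hs hw hM huc).1 hu.interface]
  exact huc

/-! ### Plane waves in terms of Jost solutions -/

/-- The coefficient of `χ₊` is the Wronskian of the plane wave with `χ₋`, computed at `a`, divided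
by `w`. The value of `γ` is irrelevant: the free reflection coefficient absorbs it. -/
theorem exists_cexp_eq_comb_left (hV : Integrable V volume) (hs : essSupport V = Icc a b)
    (hw : jostFunction V a b ζ ≠ 0) : ∃ γ, ∀ x, x < a → Complex.exp (Complex.I * ζ * x) =
      comb (jostPlus V b ζ) (jostMinus V a ζ)
        (-(2 * Complex.I * ζ) / jostFunction V a b ζ, γ) x := by
  have hsol : SolvesOn V (ζ ^ 2) (Iic a) (fun x : ℝ => Complex.exp (Complex.I * ζ * x)) :=
    solvesOn_cexp (ae_eq_zero_Iic hs) (by rw [mul_pow, Complex.I_sq]; ring)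
  obtain ⟨m0, m1⟩ := jostMinus_of_le hV hs ζ (le_refl a)
  have hW : wronskian (fun x : ℝ => Complex.exp (Complex.I * ζ * x)) (jostMinus V a ζ) a =
      -(2 * Complex.I * ζ) := by
    rw [wronskian, m0, m1, (hasDerivAt_cexp_mul _ a).deriv, Complex.exp_neg]
    have := Complex.exp_ne_zero (Complex.I * ζ * a)
    field_simp
    ring
  have h := fun (x : ℝ) (hx : x ∈ Iic a) => hsol.exists_comb hV hs hw self_mem_Iic hx
  rw [hW] at h
  exact ⟨_, fun x hx => h x hx.le⟩

theorem exists_cexp_eq_comb_right (hV : Integrable V volume) (hs : essSupport V = Icc a b)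
    (hw : jostFunction V a b ζ ≠ 0) : ∃ γ, ∀ x, b < x → Complex.exp (-(Complex.I * ζ * x)) =
      comb (jostPlus V b ζ) (jostMinus V a ζ)
        (γ, -(2 * Complex.I * ζ) / jostFunction V a b ζ) x := by
  have hsol : SolvesOn V (ζ ^ 2) (Ici b) (fun x : ℝ => Complex.exp (-(Complex.I * ζ) * x)) :=
    solvesOn_cexp (ae_eq_zero_Ici hs) (by rw [neg_sq, mul_pow, Complex.I_sq]; ring)
  obtain ⟨m0, m1⟩ := jostPlus_of_le hV hs ζ (le_refl b)
  have hW : wronskian (fun x : ℝ => Complex.exp (-(Complex.I * ζ) * x)) (jostPlus V b ζ) b =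
      2 * Complex.I * ζ := by
    rw [wronskian, m0, m1, (hasDerivAt_cexp_mul _ b).deriv, neg_mul, Complex.exp_neg]
    have := Complex.exp_ne_zero (Complex.I * ζ * b)
    field_simp
    ring
  have h := fun (x : ℝ) (hx : x ∈ Ici b) => hsol.exists_comb hV hs hw self_mem_Ici hx
  rw [hW] at h
  exact ⟨_, fun x hx => by rw [← neg_mul]; exact h x hx.le⟩

theorem isIncoming_iff_of_nonneg (hV : Integrable V volume) (hs : essSupport V = Icc a b) {k : ℝ}
    (hk : 0 ≤ k) (hw : jostFunction V a b k ≠ 0) :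
    IsIncoming V a b k θ u ↔
      IsJostIncoming V a b k (-(2 * Complex.I * k) / jostFunction V a b k, 0) θ u := by
  obtain ⟨γ, hγ⟩ := exists_cexp_eq_comb_left hV hs hw
  have hN : ∀ x, x < a → jostMinus V a k x = Complex.exp (-(Complex.I * k * x)) :=
    fun x hx => (jostMinus_of_le hV hs k hx.le).1
  have hP : ∀ x, b < x → jostPlus V b k x = Complex.exp (Complex.I * k * x) :=
    fun x hx => (jostPlus_of_le hV hs k hx.le).1
  constructor
  · intro h
    obtain ⟨R, T, hR, hT⟩ := h.exterior_nonneg hk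
    refine ⟨h.solves, ⟨h.value_b, h.deriv_b, h.value_a, h.deriv_a⟩, ⟨γ + R, fun x hx => ?_⟩,
      ⟨T, fun x hx => ?_⟩⟩
    · rw [hR x hx, hγ x hx, ← hN x hx, comb, comb]; ring
    · rw [hT x hx, ← hP x hx, comb]; ring
  · intro h
    obtain ⟨β, hβ⟩ := h.left
    obtain ⟨α, hα⟩ := h.right
    refine ⟨h.solves, h.interface.value_b, h.interface.deriv_b, h.interface.value_a,
      h.interface.deriv_a, fun _ => ⟨β - γ, α, fun x hx => ?_, fun x hx => ?_⟩,
      fun hk' => absurd hk (not_le.2 hk')⟩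
    · rw [hβ x hx, hγ x hx, ← hN x hx, comb, comb]; ring
    · rw [hα x hx, ← hP x hx, comb]; ring

/-- At momentum `-k > 0` the wave `exp(ikx)` is `χ₋` on the left and `exp(-ikx)` is `χ₊` on the
right, so the two sides exchange roles. -/
theorem isIncoming_iff_of_neg (hV : Integrable V volume) (hs : essSupport V = Icc a b) {k : ℝ}
    (hk : k < 0) (hw : jostFunction V a b (-k : ℂ) ≠ 0) :
    IsIncoming V a b k θ u ↔
      IsJostIncoming V a b (-k : ℂ) (0, 2 * Complex.I * k / jostFunction V a b (-k : ℂ)) θ u := by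
  obtain ⟨γ, hγ⟩ := exists_cexp_eq_comb_right hV hs hw
  have hz : -(2 * Complex.I * (-k : ℂ)) = 2 * Complex.I * k := by ring
  have hn : ∀ x : ℝ, Complex.I * (-k : ℂ) * x = -(Complex.I * k * x) := fun x => by ring
  simp only [hz, hn, neg_neg] at hγ
  have hN : ∀ x, x < a → jostMinus V a (-k) x = Complex.exp (Complex.I * k * x) :=
    fun x hx => by rw [(jostMinus_of_le hV hs (-k) hx.le).1, hn, neg_neg]
  have hP : ∀ x, b < x → jostPlus V b (-k) x = Complex.exp (-(Complex.I * k * x)) :=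
    fun x hx => by rw [(jostPlus_of_le hV hs (-k) hx.le).1, hn]
  constructor
  · intro h
    obtain ⟨R, T, hT, hR⟩ := h.exterior_neg hk
    refine ⟨by rw [neg_sq]; exact h.solves, ⟨h.value_b, h.deriv_b, h.value_a, h.deriv_a⟩,
      ⟨T, fun x hx => ?_⟩, ⟨γ + R, fun x hx => ?_⟩⟩
    · rw [hT x hx, ← hN x hx, comb]; ring
    · rw [hR x hx, hγ x hx, ← hP x hx, comb, comb]; ring
  · intro h
    obtain ⟨β, hβ⟩ := h.left
    obtain ⟨α, hα⟩ := h.right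
    refine ⟨by rw [← neg_sq]; exact h.solves, h.interface.value_b, h.interface.deriv_b,
      h.interface.value_a, h.interface.deriv_a, fun hk' => absurd hk (not_lt.2 hk'),
      fun _ => ⟨α - γ, β, fun x hx => ?_, fun x hx => ?_⟩⟩
    · rw [hβ x hx, ← hN x hx, comb]; ring
    · rw [hα x hx, hγ x hx, ← hP x hx, comb, comb]; ring

theorem psiZero_of_nonneg {k : ℝ} (hk : 0 ≤ k) : psiZero V a b k =
    comb (jostPlus V b k) (jostMinus V a k)
      (-(2 * Complex.I * k) / jostFunction V a b k, 0) := by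
  funext x
  simp [psiZero, comb, hk]

theorem psiZero_of_neg {k : ℝ} (hk : k < 0) : psiZero V a b k =
    comb (jostPlus V b (-k)) (jostMinus V a (-k))
      (0, 2 * Complex.I * k / jostFunction V a b (-k : ℂ)) := by
  funext x
  simp [psiZero, comb, not_le.2 hk]

theorem combDefect_defectCoeff (x : ℝ) : combDefect V a b ζ z (defectCoeff V a b ζ z θ) x =
    comb (jostPlus V b ζ) (jostMinus V a ζ) z x - ∑ i : Fin 4, ∑ j : Fin 4,
      ((matM V a b ζ θ)⁻¹ * matB θ) i j *
        boundaryOne a b (comb (jostPlus V b ζ) (jostMinus V a ζ) z) j * defectFun V a b i ζ x := by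
  simp only [combDefect, defectCoeff, Pi.neg_apply, neg_mul, Finset.sum_neg_distrib,
    ← sub_eq_add_neg, Matrix.mulVec, dotProduct, Finset.sum_mul]

end Interface

/-! ### Uniform invertibility of the interface matrix -/

section Bounds

variable {V : ℝ → ℝ} {a b : ℝ}

/-- The boundary values of the Jost solutions, relative to the Jost function. -/
theorem exists_jost_bound (hab : a < b) (hV : Integrable V volume) (hs : essSupport V = Icc a b)
    (hpos : FormPositive V a b) : ∃ C : ℝ, 0 < C ∧ ∀ k : ℝ,
      (1 + |k|) ≤ C * ‖jostFunction V a b k‖ ∧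
      (1 + |k|) * ‖jostPlus V b k a‖ ≤ C * ‖jostFunction V a b k‖ ∧
      ‖deriv (jostPlus V b k) a‖ ≤ C * ‖jostFunction V a b k‖ ∧
      (1 + |k|) * ‖jostMinus V a k b‖ ≤ C * ‖jostFunction V a b k‖ ∧
      ‖deriv (jostMinus V a k) b‖ ≤ C * ‖jostFunction V a b k‖ := by
  have hw := jostFunction_ne_zero hab hV hs hpos
  have hof := Complex.continuous_ofReal
  have cw := (continuous_jostFunction hV hs).comp hof
  have cP := (continuous_jostPlus hV hs a).1.comp hof
  have cP' := (continuous_jostPlus hV hs a).2.comp hof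
  have cN := (continuous_jostMinus hV hs b).1.comp hof
  have cN' := (continuous_jostMinus hV hs b).2.comp hof
  have hcont : Continuous fun k : ℝ => ((1 + |k|) + (1 + |k|) * ‖jostPlus V b k a‖ +
      ‖deriv (jostPlus V b k) a‖ + (1 + |k|) * ‖jostMinus V a k b‖ +
      ‖deriv (jostMinus V a k) b‖) / ‖jostFunction V a b k‖ := by
    have ck : Continuous fun k : ℝ => 1 + |k| := by fun_prop
    exact ((((ck.add (ck.mul cP.norm)).add cP'.norm).add (ck.mul cN.norm)).add cN'.norm).div cw.norm
      fun k => norm_ne_zero_iff.2 (hw k)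
  -- Small momenta are handled by compactness and `w ≠ 0`, large ones by the two identities for
  -- `|w|²` with `1 + |k| ≤ 2|k|`.
  obtain ⟨C, hC⟩ := isCompact_Icc.exists_bound_of_continuousOn (s := Icc (-1 : ℝ) 1)
    hcont.continuousOn
  refine ⟨max C 2, by positivity, fun k => ?_⟩
  have hwk : 0 < ‖jostFunction V a b k‖ := norm_pos_iff.2 (hw k)
  rcases le_or_gt |k| 1 with hk | hk
  · have h := (le_abs_self _).trans (hC k (abs_le.1 hk))
    rw [div_le_iff₀ hwk] at h
    have hmax : C * ‖jostFunction V a b k‖ ≤ max C 2 * ‖jostFunction V a b k‖ := by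
      gcongr; exact le_max_left _ _
    have h1 : 0 ≤ 1 + |k| := by positivity
    have h2 : 0 ≤ (1 + |k|) * ‖jostPlus V b k a‖ := by positivity
    have h3 := norm_nonneg (deriv (jostPlus V b k) a)
    have h4 : 0 ≤ (1 + |k|) * ‖jostMinus V a k b‖ := by positivity
    have h5 := norm_nonneg (deriv (jostMinus V a k) b)
    refine ⟨?_, ?_, ?_, ?_, ?_⟩ <;> linarith
  · have hmax : 2 * ‖jostFunction V a b k‖ ≤ max C 2 * ‖jostFunction V a b k‖ := by
      gcongr; exact le_max_right _ _
    have key : ∀ p p' : ℝ, 0 ≤ p → 0 ≤ p' →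
        ‖jostFunction V a b k‖ ^ 2 = k ^ 2 * p ^ 2 + p' ^ 2 + 2 * k ^ 2 →
        |k| ≤ ‖jostFunction V a b k‖ ∧ |k| * p ≤ ‖jostFunction V a b k‖ ∧
          p' ≤ ‖jostFunction V a b k‖ := by
      intro p p' hp hp' h
      rw [← sq_abs k] at h
      refine ⟨?_, ?_, ?_⟩ <;> refine le_of_sq_le_sq ?_ hwk.le <;> rw [h] <;>
        nlinarith [sq_nonneg |k|, sq_nonneg p', sq_nonneg (|k| * p)]
    obtain ⟨a1, a2, a3⟩ := key _ _ (norm_nonneg _) (norm_nonneg _)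
      (norm_jostFunction_sq_plus hV hs k)
    obtain ⟨-, b2, b3⟩ := key _ _ (norm_nonneg _) (norm_nonneg _)
      (norm_jostFunction_sq_minus hV hs k)
    have h2 := mul_le_mul_of_nonneg_right hk.le (norm_nonneg (jostPlus V b k a))
    have h4 := mul_le_mul_of_nonneg_right hk.le (norm_nonneg (jostMinus V a k b))
    refine ⟨?_, ?_, ?_, ?_, ?_⟩ <;> linarith

/-- The weights balancing values (weight `1`) and derivatives (weight `1 + |k|`). -/
noncomputable def traceWeight (k : ℝ) : Fin 4 → ℝ := ![1, 1 + |k|, 1, 1 + |k|]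

theorem traceWeight_pos (k : ℝ) (i : Fin 4) : 0 < traceWeight k i := by
  fin_cases i <;> simp [traceWeight] <;> positivity

/-- Each product in an entry of `w q` has a factor `χ₊` at `b` or `χ₋` at `a`, possibly
differentiated. That factor is explicit and bounded by its weight; the other is bounded relative to
`w` by `exists_jost_bound`. -/
theorem exists_weylMatrix_bound (hab : a < b) (hV : Integrable V volume)
    (hs : essSupport V = Icc a b) (hpos : FormPositive V a b) : ∃ C : ℝ, 0 < C ∧ ∀ (k : ℝ) i j,
      ‖weylMatrix V a b k i j‖ ≤ C * (traceWeight k i * traceWeight k j / (1 + |k|)) := by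
  obtain ⟨C, hC, h⟩ := exists_jost_bound hab hV hs hpos
  refine ⟨C, hC, fun k i j => ?_⟩
  obtain ⟨h0, h1, h2, h3, h4⟩ := h k
  have hwk : 0 < ‖jostFunction V a b k‖ :=
    norm_pos_iff.2 (jostFunction_ne_zero hab hV hs hpos k)
  have hκ : 0 < 1 + |k| := by positivity
  have nPb : ‖jostPlus V b k b‖ ≤ 1 := by
    rw [(jostPlus_of_le hV hs k le_rfl).1, norm_exp_I_mul]
  have nPb' : ‖deriv (jostPlus V b k) b‖ ≤ 1 + |k| := by
    rw [(jostPlus_of_le hV hs k le_rfl).2, norm_mul, norm_exp_I_mul]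
    simp
  have nNa : ‖jostMinus V a k a‖ ≤ 1 := by
    rw [(jostMinus_of_le hV hs k le_rfl).1, norm_exp_neg_I_mul]
  have nNa' : ‖deriv (jostMinus V a k) a‖ ≤ 1 + |k| := by
    rw [(jostMinus_of_le hV hs k le_rfl).2, norm_mul, norm_exp_neg_I_mul]
    simp
  have key : ∀ {x y : ℂ} {s t r : ℝ}, (1 + |k|) * ‖x‖ ≤ s * (C * ‖jostFunction V a b k‖) →
      ‖y‖ ≤ t → s * t = r → ‖x * y‖ ≤ C * ‖jostFunction V a b k‖ * (r / (1 + |k|)) := by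
    intro x y s t r hx hy hr
    rw [← hr, norm_mul, mul_div_assoc', le_div_iff₀ hκ]
    calc ‖x‖ * ‖y‖ * (1 + |k|) = (1 + |k|) * ‖x‖ * ‖y‖ := by ring
      _ ≤ s * (C * ‖jostFunction V a b k‖) * t :=
          mul_le_mul hx hy (norm_nonneg _) ((by positivity : (0 : ℝ) ≤ _).trans hx)
      _ = _ := by ring
  have key' : ∀ {x y : ℂ} {s t r : ℝ}, (1 + |k|) * ‖x‖ ≤ s * (C * ‖jostFunction V a b k‖) →
      ‖y‖ ≤ t → s * t = r → ‖y * x‖ ≤ C * ‖jostFunction V a b k‖ * (r / (1 + |k|)) :=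
    fun hx hy hr => by rw [mul_comm]; exact key hx hy hr
  have avg : ∀ {x y : ℂ} {r : ℝ}, ‖x‖ ≤ r → ‖y‖ ≤ r → ‖(x + y) / 2‖ ≤ r := by
    intro x y r hx hy
    rw [norm_div, Complex.norm_ofNat, div_le_iff₀ two_pos]
    linarith [norm_add_le x y]
  have dNb : (1 + |k|) * ‖jostMinus V a k b‖ ≤ 1 * (C * ‖jostFunction V a b k‖) := by
    rwa [one_mul]
  have dNb' : (1 + |k|) * ‖deriv (jostMinus V a k) b‖ ≤
      (1 + |k|) * (C * ‖jostFunction V a b k‖) := by gcongr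
  have dPa : (1 + |k|) * ‖jostPlus V b k a‖ ≤ 1 * (C * ‖jostFunction V a b k‖) := by
    rwa [one_mul]
  have dPa' : (1 + |k|) * ‖deriv (jostPlus V b k) a‖ ≤
      (1 + |k|) * (C * ‖jostFunction V a b k‖) := by gcongr
  have dNa : (1 + |k|) * ‖jostMinus V a k a‖ ≤ 1 * (C * ‖jostFunction V a b k‖) := by
    rw [one_mul]
    exact (mul_le_of_le_one_right hκ.le nNa).trans h0
  have dNa' : (1 + |k|) * ‖deriv (jostMinus V a k) a‖ ≤
      (1 + |k|) * (C * ‖jostFunction V a b k‖) := by gcongr; exact nNa'.trans h0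
  rw [weylMatrix_eq hab hV hs, Matrix.smul_apply, smul_eq_mul, norm_mul, norm_inv,
    inv_mul_le_iff₀ hwk, ← mul_assoc, mul_comm ‖jostFunction V a b k‖ C]
  fin_cases i <;> fin_cases j <;>
    simp only [traceWeight, Fin.zero_eta, Fin.mk_one, Fin.reduceFinMk, Matrix.cons_val,
      Matrix.of_apply]
  · exact key dNb nPb (by ring)
  · exact avg (key dNb' nPb (by ring)) (key dNb nPb' (by ring))
  · exact key dNa nPb (by ring)
  · exact key dNa' nPb (by ring)
  · exact avg (key dNb' nPb (by ring)) (key dNb nPb' (by ring))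
  · exact key dNb' nPb' (by ring)
  · exact key dNa nPb' (by ring)
  · exact key dNa' nPb' (by ring)
  · exact key dNa nPb (by ring)
  · exact key dNa nPb' (by ring)
  · exact key' dPa nNa (by ring)
  · exact avg (key' dPa nNa' (by ring)) (key' dPa' nNa (by ring))
  · exact key dNa' nPb (by ring)
  · exact key dNa' nPb' (by ring)
  · exact avg (key' dPa nNa' (by ring)) (key' dPa' nNa (by ring))
  · exact key' dPa' nNa' (by ring)

/-- Conjugation by `diag(s)` fixes the diagonal and brings the three other entries of each row below
`r`, so the Gershgorin criterion applies. -/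
theorem isUnit_of_scaled_dominant {M : Matrix (Fin 4) (Fin 4) ℂ} {s : Fin 4 → ℝ}
    (hs : ∀ i, 0 < s i) {r : ℝ} (hoff : ∀ i j, i ≠ j → ‖M i j‖ ≤ r * (s j / s i))
    (hdiag : ∀ i, 3 * r < ‖M i i‖) : IsUnit M := by
  rw [Matrix.isUnit_iff_isUnit_det, isUnit_iff_ne_zero]
  intro h0
  refine det_ne_zero_of_sum_row_lt_diag
    (A := Matrix.diagonal (fun i => (s i : ℂ)) * M * Matrix.diagonal fun i => (s i : ℂ)⁻¹)
    (fun i => ?_) (by rw [Matrix.det_mul, Matrix.det_mul, h0]; ring)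
  have hsi : (s i : ℂ) ≠ 0 := Complex.ofReal_ne_zero.2 (hs i).ne'
  simp only [Matrix.mul_diagonal, Matrix.diagonal_mul]
  have hd : (s i : ℂ) * M i i * (s i : ℂ)⁻¹ = M i i := by field_simp
  rw [hd]
  refine lt_of_le_of_lt ?_ (hdiag i)
  calc ∑ j ∈ Finset.univ.erase i, ‖(s i : ℂ) * M i j * (s j : ℂ)⁻¹‖
      ≤ ∑ j ∈ Finset.univ.erase i, r := by
        refine Finset.sum_le_sum fun j hj => ?_
        have h := hoff i j (Finset.ne_of_mem_erase hj).symm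
        have := hs i
        have := hs j
        rw [norm_mul, norm_mul, norm_inv, Complex.norm_real, Complex.norm_real,
          Real.norm_of_nonneg (hs i).le, Real.norm_of_nonneg (hs j).le]
        calc s i * ‖M i j‖ * (s j)⁻¹ ≤ s i * (r * (s j / s i)) * (s j)⁻¹ := by gcongr
          _ = r := by field_simp
    _ = 3 * r := by simp

theorem exists_ball_exp_sub_one_le {ε : ℝ} (hε : 0 < ε) : ∃ δ : ℝ, 0 < δ ∧
    ∀ θ ∈ Metric.ball (0 : ℂ × ℂ) δ, ‖Complex.exp (θ.1 / 2) - 1‖ ≤ ε ∧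
      ‖Complex.exp (-θ.1 / 2) - 1‖ ≤ ε ∧ ‖Complex.exp (θ.2 / 2) - 1‖ ≤ ε ∧
      ‖Complex.exp (-θ.2 / 2) - 1‖ ≤ ε := by
  have key : ∀ f : ℂ × ℂ → ℂ, Continuous f → f 0 = 0 →
      ∀ᶠ θ in 𝓝 (0 : ℂ × ℂ), ‖Complex.exp (f θ) - 1‖ ≤ ε := by
    intro f hf h0
    have hc : Continuous fun θ => ‖Complex.exp (f θ) - 1‖ := by fun_prop
    exact (hc.tendsto 0).eventually_le_const (by simpa [h0] using hε)
  obtain ⟨δ, hδ, h⟩ := Metric.eventually_nhds_iff_ball.1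
    (((key (fun θ => θ.1 / 2) (by fun_prop) (by simp)).and
      (key (fun θ => -θ.1 / 2) (by fun_prop) (by simp))).and
      ((key (fun θ => θ.2 / 2) (by fun_prop) (by simp)).and
      (key (fun θ => -θ.2 / 2) (by fun_prop) (by simp))))
  exact ⟨δ, hδ, fun θ hθ => ⟨(h θ hθ).1.1, (h θ hθ).1.2, (h θ hθ).2.1, (h θ hθ).2.2⟩⟩

theorem exists_isUnit_matM (hab : a < b) (hV : Integrable V volume)
    (hs : essSupport V = Icc a b) (hpos : FormPositive V a b) : ∃ δ : ℝ, 0 < δ ∧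
      ∀ k : ℝ, ∀ θ ∈ Metric.ball (0 : ℂ × ℂ) δ, IsUnit (matM V a b (k : ℂ) θ) := by
  obtain ⟨C, hC, hq⟩ := exists_weylMatrix_bound hab hV hs hpos
  -- Dominance requires `3 * (2εC) < (2 - ε) - 2εC`, that is `8εC + ε < 2`; this choice makes the
  -- left side `1`.
  obtain ⟨δ, hδ, hexp⟩ := exists_ball_exp_sub_one_le (ε := 1 / (8 * C + 1)) (by positivity)
  refine ⟨δ, hδ, fun k θ hθ => ?_⟩
  obtain ⟨e1, e2, e3, e4⟩ := hexp θ hθ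
  set ε := 1 / (8 * C + 1) with hε
  have hε0 : 0 < ε := by positivity
  have hεC : 8 * (ε * C) + ε = 1 := by rw [hε]; field_simp
  have hκ : 0 < 1 + |k| := by positivity
  have hB : ∀ i j, ‖(matB θ * weylMatrix V a b k) i j‖ ≤
      2 * ε * C * (traceWeight k j / traceWeight k i) := by
    intro i j
    have hcol : (matB θ * weylMatrix V a b k) i j =
        (matB θ).mulVec (fun l => weylMatrix V a b k l j) i := rfl
    -- Row `i` of `B` has its only entry in the partner column `l`, one index being a value and the
    -- other a derivative; their weights multiply to `1 + |k|` and cancel the denominator.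
    have hstep : ∀ {β : ℂ} {l : Fin 4}, ‖β‖ ≤ ε →
        traceWeight k l * traceWeight k i = 1 + |k| →
        ‖2 * β * weylMatrix V a b k l j‖ ≤ 2 * ε * C * (traceWeight k j / traceWeight k i) := by
      intro β l hβ hl
      have hi := traceWeight_pos k i
      have hlp := traceWeight_pos k l
      rw [norm_mul, norm_mul, Complex.norm_ofNat]
      calc 2 * ‖β‖ * ‖weylMatrix V a b k l j‖
          ≤ 2 * ε * (C * (traceWeight k l * traceWeight k j / (1 + |k|))) := by
            gcongr; exact hq k l j
        _ = _ := by rw [← hl]; field_simp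
    rw [hcol, matB_mulVec]
    fin_cases i
    · exact hstep (by rwa [norm_sub_rev]) (by simp [traceWeight])
    · exact hstep e1 (by simp [traceWeight])
    · exact hstep (by rwa [norm_sub_rev]) (by simp [traceWeight])
    · exact hstep e2 (by simp [traceWeight])
  refine isUnit_of_scaled_dominant (r := 2 * ε * C) (traceWeight_pos k) (fun i j hij => ?_)
    fun i => ?_
  · have := hB i j
    rwa [matM, Matrix.sub_apply, matA, Matrix.diagonal_apply_ne _ hij, sub_zero]
  · have h1 := hB i i
    rw [div_self (traceWeight_pos k i).ne', mul_one] at h1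
    have hA : ∀ {e : ℂ}, ‖e - 1‖ ≤ ε → 2 - ε ≤ ‖1 + e‖ := by
      intro e he
      have : ‖(2 : ℂ)‖ ≤ ‖1 + e‖ + ‖e - 1‖ := by
        have := norm_sub_le (1 + e) (e - 1)
        rwa [show 1 + e - (e - 1) = 2 by ring] at this
      rw [Complex.norm_ofNat] at this
      linarith
    have h2 : 2 - ε ≤ ‖matA θ i i‖ := by
      rw [matA, Matrix.diagonal_apply_eq]
      fin_cases i
      · exact hA e3
      · exact hA e1
      · exact hA e4
      · exact hA e2
    have h3 : ‖matA θ i i‖ ≤ ‖matM V a b k θ i i‖ + ‖(matB θ * weylMatrix V a b k) i i‖ := by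
      have := norm_sub_le ((matB θ * weylMatrix V a b k) i i) (matM V a b k θ i i)
      rw [matM, Matrix.sub_apply, sub_sub_cancel] at this
      rw [matM, Matrix.sub_apply]
      linarith
    linarith

end Bounds

/-! ### Regularity in the momentum and in the interface parameters -/

section Regularity

variable {V : ℝ → ℝ} {a b : ℝ}

theorem differentiableAt_det {A : ℂ × ℂ → Matrix (Fin 4) (Fin 4) ℂ} {θ : ℂ × ℂ}
    (h : ∀ i j, DifferentiableAt ℂ (fun θ => A θ i j) θ) :
    DifferentiableAt ℂ (fun θ => (A θ).det) θ := by
  simp only [Matrix.det_apply, Fin.prod_univ_four]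
  exact DifferentiableAt.fun_sum fun σ _ =>
    ((((h _ _).mul (h _ _)).mul (h _ _)).mul (h _ _)).const_smul _

theorem differentiableAt_adjugate {A : ℂ × ℂ → Matrix (Fin 4) (Fin 4) ℂ} {θ : ℂ × ℂ}
    (h : ∀ i j, DifferentiableAt ℂ (fun θ => A θ i j) θ) (i j : Fin 4) :
    DifferentiableAt ℂ (fun θ => (A θ).adjugate i j) θ := by
  simp only [Matrix.adjugate_apply]
  refine differentiableAt_det fun p q => ?_
  simp only [Matrix.updateRow_apply]
  split_ifs
  · exact differentiableAt_const _
  · exact h p q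

/-- By Cramer's rule the inverse is the adjugate over the determinant, both polynomial in the
entries. -/
theorem differentiableAt_inv_apply {A : ℂ × ℂ → Matrix (Fin 4) (Fin 4) ℂ} {θ : ℂ × ℂ}
    (h : ∀ i j, DifferentiableAt ℂ (fun θ => A θ i j) θ) (hA : IsUnit (A θ)) (i j : Fin 4) :
    DifferentiableAt ℂ (fun θ => (A θ)⁻¹ i j) θ := by
  have hdet := ((Matrix.isUnit_iff_isUnit_det _).1 hA).ne_zero
  simp only [Matrix.inv_def, Ring.inverse_eq_inv', Matrix.smul_apply, smul_eq_mul]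
  exact ((differentiableAt_det h).inv hdet).mul (differentiableAt_adjugate h i j)

theorem differentiable_matB_apply (i j : Fin 4) :
    Differentiable ℂ fun θ : ℂ × ℂ => matB θ i j := by
  fin_cases i <;> fin_cases j <;>
    simp only [matB, Fin.zero_eta, Fin.mk_one, Fin.reduceFinMk, Matrix.cons_val,
      Matrix.of_apply] <;> fun_prop

theorem differentiable_matA_apply (i j : Fin 4) :
    Differentiable ℂ fun θ : ℂ × ℂ => matA θ i j := by
  simp only [matA, Matrix.diagonal_apply]
  split_ifs
  · fin_cases i <;>
      simp only [Fin.zero_eta, Fin.mk_one, Fin.reduceFinMk, Matrix.cons_val] <;> fun_prop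
  · fun_prop

theorem differentiable_matM_apply (ζ : ℂ) (i j : Fin 4) :
    Differentiable ℂ fun θ : ℂ × ℂ => matM V a b ζ θ i j := by
  simp only [matM, Matrix.sub_apply, Matrix.mul_apply]
  exact (Differentiable.fun_sum fun l _ => (differentiable_matB_apply i l).mul_const _).sub
    (differentiable_matA_apply i j)

theorem differentiableAt_combDefect {ζ : ℂ} {θ : ℂ × ℂ} (hM : IsUnit (matM V a b ζ θ))
    (z : ℂ × ℂ) (x : ℝ) :
    DifferentiableAt ℂ (fun θ => combDefect V a b ζ z (defectCoeff V a b ζ z θ) x) θ := by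
  have h := differentiableAt_inv_apply
    (fun i j => (differentiable_matM_apply (V := V) (a := a) (b := b) ζ i j) θ) hM
  simp only [combDefect, defectCoeff, Pi.neg_apply, Matrix.mulVec, dotProduct, Matrix.mul_apply]
  refine (differentiableAt_const _).add (DifferentiableAt.fun_sum fun i _ =>
    (DifferentiableAt.fun_neg (DifferentiableAt.fun_sum fun j _ => ?_)).mul_const _)
  exact (DifferentiableAt.fun_sum fun l _ =>
    (h i l).mul (differentiable_matB_apply l j θ)).mul_const _

/-- Continuity of the solution of the interface problem along a curve of momenta. -/
theorem continuous_combDefect (hab : a < b) (hV : Integrable V volume)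
    (hs : essSupport V = Icc a b) {s : ℝ → ℂ} (hsc : Continuous s)
    (hw : ∀ k, jostFunction V a b (s k) ≠ 0) {θ : ℂ × ℂ} (hM : ∀ k, IsUnit (matM V a b (s k) θ))
    {z : ℝ → ℂ × ℂ} (hz : Continuous z) (x : ℝ) :
    Continuous fun k => combDefect V a b (s k) (z k) (defectCoeff V a b (s k) (z k) θ) x := by
  have cP : ∀ x, Continuous fun k => jostPlus V b (s k) x := fun x =>
    (continuous_jostPlus hV hs x).1.comp hsc
  have cP' : ∀ x, Continuous fun k => deriv (jostPlus V b (s k)) x := fun x =>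
    (continuous_jostPlus hV hs x).2.comp hsc
  have cN : ∀ x, Continuous fun k => jostMinus V a (s k) x := fun x =>
    (continuous_jostMinus hV hs x).1.comp hsc
  have cN' : ∀ x, Continuous fun k => deriv (jostMinus V a (s k)) x := fun x =>
    (continuous_jostMinus hV hs x).2.comp hsc
  have cw : Continuous fun k => (jostFunction V a b (s k))⁻¹ :=
    ((continuous_jostFunction hV hs).comp hsc).inv₀ hw
  have cφ : ∀ x, Continuous fun k => comb (jostPlus V b (s k)) (jostMinus V a (s k)) (z k) x :=
    fun x => (hz.fst.mul (cP x)).add (hz.snd.mul (cN x))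
  have cφ' : ∀ x, Continuous fun k =>
      comb (deriv (jostPlus V b (s k))) (deriv (jostMinus V a (s k))) (z k) x :=
    fun x => (hz.fst.mul (cP' x)).add (hz.snd.mul (cN' x))
  have cΓ : Continuous fun k =>
      boundaryOne a b (comb (jostPlus V b (s k)) (jostMinus V a (s k)) (z k)) := by
    simp only [boundaryOne_comb hab hV hs]
    refine continuous_pi fun i => ?_
    fin_cases i
    · exact cφ b
    · exact cφ' b
    · exact cφ a
    · exact cφ' a
  have cq : Continuous fun k => weylMatrix V a b (s k) := by
    simp only [weylMatrix_eq hab hV hs]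
    refine cw.smul (continuous_matrix fun i j => ?_)
    have := cP a
    have := cP b
    have := cP' a
    have := cP' b
    have := cN a
    have := cN b
    have := cN' a
    have := cN' b
    fin_cases i <;> fin_cases j <;>
      simp only [Fin.zero_eta, Fin.mk_one, Fin.reduceFinMk, Matrix.cons_val,
        Matrix.of_apply] <;> fun_prop
  have cM : Continuous fun k => matM V a b (s k) θ :=
    (continuous_const.matrix_mul cq).sub continuous_const
  have cMinv : Continuous fun k => (matM V a b (s k) θ)⁻¹ := by
    simp only [Matrix.inv_def, Ring.inverse_eq_inv']
    exact (cM.matrix_det.inv₀ fun k =>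
      ((Matrix.isUnit_iff_isUnit_det _).1 (hM k)).ne_zero).smul cM.matrix_adjugate
  have cc : Continuous fun k => defectCoeff V a b (s k) (z k) θ :=
    ((cMinv.matrix_mul continuous_const).matrix_mulVec cΓ).neg
  have cg : ∀ i, Continuous fun k => defectFun V a b i (s k) x := by
    intro i
    have := cP x
    have := cN x
    have := cP a
    have := cP b
    have := cP' a
    have := cP' b
    have := cN a
    have := cN b
    have := cN' a
    have := cN' b
    fin_cases i <;>
      simp only [defectFun, greenG, greenH, one_div, Fin.zero_eta, Fin.mk_one, Fin.reduceFinMk,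
        Matrix.cons_val] <;> split_ifs <;> fun_prop
  exact (cφ x).add (continuous_finsetSum _ fun i _ => ((continuous_apply i).comp cc).mul (cg i))

end Regularity

end InterfaceSchrodinger

/-! ### The generalized eigenfunctions: existence, formula and regularity -/

theorem proposition4 (a b : ℝ) (hab : a < b) (V : ℝ → ℝ) (hV : Integrable V volume)
    (hsupp : essSupport V = Icc a b) (hpos : FormPositive V a b) :
    ∃ δ : ℝ, 0 < δ ∧
      (∀ k : ℝ, ∀ θ ∈ Metric.ball (0 : ℂ × ℂ) δ, IsUnit (matM V a b (k : ℂ) θ)) ∧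
      (∀ k : ℝ, ∀ θ ∈ Metric.ball (0 : ℂ × ℂ) δ, ∃ u : ℝ → ℂ, IsIncoming V a b k θ u) ∧
      ∀ ψ : ℝ → ℂ × ℂ → ℝ → ℂ,
        (∀ k : ℝ, ∀ θ ∈ Metric.ball (0 : ℂ × ℂ) δ, IsIncoming V a b k θ (ψ k θ)) →
        (∀ k : ℝ, 0 ≤ k → ∀ θ ∈ Metric.ball (0 : ℂ × ℂ) δ, ∀ x ∈ ({a, b}ᶜ : Set ℝ),
          ψ k θ x = psiZero V a b k x - ∑ i : Fin 4, ∑ j : Fin 4,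
            ((matM V a b (k : ℂ) θ)⁻¹ * matB θ) i j *
              boundaryOne a b (psiZero V a b k) j * defectFun V a b i (k : ℂ) x) ∧
        (∀ k : ℝ, k < 0 → ∀ θ ∈ Metric.ball (0 : ℂ × ℂ) δ, ∀ x ∈ ({a, b}ᶜ : Set ℝ),
          ψ k θ x = psiZero V a b k x - ∑ i : Fin 4, ∑ j : Fin 4,
            ((matM V a b (-k : ℂ) θ)⁻¹ * matB θ) i j *
              boundaryOne a b (psiZero V a b k) j * defectFun V a b i (-k : ℂ) x) ∧
        (∀ k : ℝ, ∀ θ ∈ Metric.ball (0 : ℂ × ℂ) δ,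
          ContDiffOn ℝ 1 (ψ k θ) ({a, b}ᶜ : Set ℝ)) ∧
        (∀ θ ∈ Metric.ball (0 : ℂ × ℂ) δ, ∀ x ∈ ({a, b}ᶜ : Set ℝ),
          Continuous fun k : ℝ => ψ k θ x) ∧
        (∀ k : ℝ, ∀ x ∈ ({a, b}ᶜ : Set ℝ),
          DifferentiableOn ℂ (fun θ : ℂ × ℂ => ψ k θ x) (Metric.ball (0 : ℂ × ℂ) δ)) := by
  obtain ⟨δ, hδ, hunit⟩ := exists_isUnit_matM hab hV hsupp hpos
  have hw : ∀ k : ℝ, jostFunction V a b (k : ℂ) ≠ 0 := jostFunction_ne_zero hab hV hsupp hpos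
  have hw' : ∀ k : ℝ, jostFunction V a b (-k : ℂ) ≠ 0 := fun k => by simpa using hw (-k)
  have hunit' : ∀ k : ℝ, ∀ θ ∈ Metric.ball (0 : ℂ × ℂ) δ, IsUnit (matM V a b (-k : ℂ) θ) :=
    fun k θ hθ => by simpa using hunit (-k) θ hθ
  set zp : ℝ → ℂ × ℂ := fun k => (-(2 * Complex.I * k) / jostFunction V a b (k : ℂ), 0) with hzp
  set zn : ℝ → ℂ × ℂ := fun k => (0, 2 * Complex.I * k / jostFunction V a b (-k : ℂ)) with hzn
  refine ⟨δ, hδ, hunit, fun k θ hθ => ?_, fun ψ hψ => ?_⟩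
  · rcases le_or_gt 0 k with hk | hk
    · exact ⟨_, (isIncoming_iff_of_nonneg hV hsupp hk (hw k)).2
        (isJostIncoming_combDefect hab hV hsupp (hw k) (hunit k θ hθ))⟩
    · exact ⟨_, (isIncoming_iff_of_neg hV hsupp hk (hw' k)).2
        (isJostIncoming_combDefect hab hV hsupp (hw' k) (hunit' k θ hθ))⟩
  -- Uniqueness identifies the arbitrary selection `ψ` with the explicit solution, which supplies
  -- its regularity in `k` and `θ`.
  have hp : ∀ k : ℝ, 0 ≤ k → ∀ θ ∈ Metric.ball (0 : ℂ × ℂ) δ, ∀ x ∈ ({a, b}ᶜ : Set ℝ),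
      ψ k θ x = combDefect V a b k (zp k) (defectCoeff V a b k (zp k) θ) x := fun k hk θ hθ =>
    ((isIncoming_iff_of_nonneg hV hsupp hk (hw k)).1 (hψ k θ hθ)).eq_combDefect hab hV hsupp
      (hw k) (hunit k θ hθ)
  have hn : ∀ k : ℝ, k < 0 → ∀ θ ∈ Metric.ball (0 : ℂ × ℂ) δ, ∀ x ∈ ({a, b}ᶜ : Set ℝ),
      ψ k θ x = combDefect V a b (-k) (zn k) (defectCoeff V a b (-k) (zn k) θ) x :=
    fun k hk θ hθ =>
      ((isIncoming_iff_of_neg hV hsupp hk (hw' k)).1 (hψ k θ hθ)).eq_combDefect hab hV hsupp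
        (hw' k) (hunit' k θ hθ)
  refine ⟨fun k hk θ hθ x hx => ?_, fun k hk θ hθ x hx => ?_, fun k θ hθ => ?_,
    fun θ hθ x hx => ?_, fun k x hx θ hθ => ?_⟩
  · rw [hp k hk θ hθ x hx, combDefect_defectCoeff, psiZero_of_nonneg hk]
  · rw [hn k hk θ hθ x hx, combDefect_defectCoeff, psiZero_of_neg hk]
  · exact (hψ k θ hθ).solves.contDiffOn hV (Set.toFinite {a, b}).isClosed.isOpen_compl
  · have hofc := Complex.continuous_ofReal
    have hcw := (continuous_jostFunction hV hsupp).comp hofc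
    have hcw' := (continuous_jostFunction hV hsupp).comp hofc.neg
    have hzpc : Continuous zp :=
      ((continuous_const.mul hofc).neg.div hcw hw).prodMk continuous_const
    have hznc : Continuous zn :=
      continuous_const.prodMk ((continuous_const.mul hofc).div hcw' hw')
    have cp := continuous_combDefect hab hV hsupp hofc hw (fun k => hunit k θ hθ) hzpc x
    have cn := continuous_combDefect hab hV hsupp hofc.neg hw' (fun k => hunit' k θ hθ) hznc x
    have heq : (fun k : ℝ => ψ k θ x) = fun k : ℝ => if 0 ≤ k
        then combDefect V a b k (zp k) (defectCoeff V a b k (zp k) θ) x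
        else combDefect V a b (-k) (zn k) (defectCoeff V a b (-k) (zn k) θ) x := by
      funext k
      split_ifs with hk
      · exact hp k hk θ hθ x hx
      · exact hn k (not_le.1 hk) θ hθ x hx
    rw [heq]
    -- The branches meet at `k = 0`: the momenta `k` and `-k` coincide there and both incoming
    -- amplitudes vanish.
    refine cp.if_le cn continuous_const continuous_id fun k hk => ?_
    subst hk
    simp [hzp, hzn]
  · refine DifferentiableAt.differentiableWithinAt ?_
    have hnhds := Metric.isOpen_ball.mem_nhds hθ
    rcases le_or_gt 0 k with hk | hk
    · exact (differentiableAt_combDefect (hunit k θ hθ) (zp k) x).congr_of_eventuallyEq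
        (eventually_of_mem hnhds fun θ hθ => hp k hk θ hθ x hx)
    · exact (differentiableAt_combDefect (hunit' k θ hθ) (zn k) x).congr_of_eventuallyEq
        (eventually_of_mem hnhds fun θ hθ => hn k hk θ hθ x hx)
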